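/- Let $q=p^r\equiv 5 \pmod 8$ with $p$ prime, and let $\mathbb F_q$ be the field with $q$ elements. Let $G_4(q)$ be the digraph with vertex set $\mathbb F_q$ in which $a\to b$ is an edge if and only if $b-a$ is a nonzero fourth power in $\mathbb F_q$, and let $\mathcal K_4(G_4(q))$ be the number of transitive subtournaments of order four contained in $G_4(q)$, i.e. the number of subgraphs of $G_4(q)$ on four vertices that are transitive tournaments. Extend every complex multiplicative character $\chi$ of $\mathbb F_q^*$ (including the trivial one $\varepsilon$) to $\mathbb F_q$ by $\chi(0)=0$. For characters $A,B$ put $J(A,B)=\sum_{a\in\mathbb F_q}A(a)B(1-a)$ and $\binom{A}{B}=\frac{B(-1)}{q}J(A,\overline B)$, and let $${}_3F_2\left(\begin{array}{ccc}A_0,&A_1,&A_2\\&B_1,&B_2\end{array}\Big|\;\lambda\right)_q=\frac{q}{q-1}\sum_{\chi}\binom{A_0\chi}{\chi}\binom{A_1\chi}{B_1\chi}\binom{A_2\chi}{B_2\chi}\chi(\lambda),$$ the sum being over all multiplicative characters $\chi$ of $\mathbb F_q^*$. Let $\varphi$ and $\chi_4$ be characters of $\mathbb F_q^*$ of order $2$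 and $4$ respectively. Then there are integers $x,y$ with $q=x^2+y^2$, $x\equiv 1\pmod 4$ and $p\nmid x$, and for all such $x,y$ $$\mathcal K_4(G_4(q))=\frac{q(q-1)}{2^{12}}\left[q^2+2q(5x-21)+24x^2-150x+241+10\,q^2\,{}_3F_2\left(\begin{array}{ccc}\chi_4,&\varphi,&\varphi\\&\varepsilon,&\varepsilon\end{array}\Big|\;1\right)_q\right].$$ -/

import Mathlib

/-- A subgraph of a digraph `G`: a set of vertices of `G` together with a set of edges of `G`
both of whose endpoints belong to that set of vertices. -/
@[ext]
structure DiSubgraph {V : Type*} (G : Digraph V) where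
  verts : Set V
  Adj : V → V → Prop
  adj_sub : ∀ {a b : V}, Adj a b → G.Adj a b
  left_mem : ∀ {a b : V}, Adj a b → a ∈ verts
  right_mem : ∀ {a b : V}, Adj a b → b ∈ verts

namespace DiSubgraph

variable {V : Type*} {G : Digraph V}

/-- A tournament: there are no loops, and any two distinct vertices are joined by an edge in
exactly one of the two directions. -/
def IsTournament (T : DiSubgraph G) : Prop :=
  (∀ a, ¬ T.Adj a a) ∧
    ∀ a ∈ T.verts, ∀ b ∈ T.verts, a ≠ b → Xor (T.Adj a b) (T.Adj b a)

/-- If `a → b` and `b → c` then `a → c`. -/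
def IsTransitive (T : DiSubgraph G) : Prop :=
  ∀ a b c, T.Adj a b → T.Adj b c → T.Adj a c

end DiSubgraph

/-- The number of transitive subtournaments of order `m` contained in the digraph `G`
(meant for a finite vertex set). -/
noncomputable def transSubtournamentCount {V : Type*} (m : ℕ) (G : Digraph V) : ℕ :=
  Nat.card {T : DiSubgraph G // T.verts.ncard = m ∧ T.IsTournament ∧ T.IsTransitive}

/-- The subgroup of `k`-th power residues in the multiplicative group of `F`. -/
def kthPowerResidues (F : Type*) [Field F] (k : ℕ) : Subgroup Fˣ :=
  (powMonoidHom k : Fˣ →* Fˣ).range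

/-- The `k`-th power Paley digraph of `F`: the vertices are the elements of `F`, and
`a → b` is an edge iff `b - a` is a (nonzero) `k`-th power residue. -/
def paleyDigraph (F : Type*) [Field F] (k : ℕ) : Digraph F where
  Adj a b := ∃ s ∈ kthPowerResidues F k, (s : F) = b - a

/-- The finite field binomial symbol of two characters, `B(-1) / q * J(A, B⁻¹)`.
All characters, including the trivial one, vanish at `0`. -/
noncomputable def charBinom {F : Type*} [Field F] [Fintype F] (A B : MulChar F ℂ) : ℂ :=
  B (-1) / (Fintype.card F : ℂ) * jacobiSum A B⁻¹

/-- Greene's finite field hypergeometric function with upper parameters `A 0, …, A n` and lower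
parameters `B 0, …, B (n - 1)` (where `B i` stands below `A (i + 1)`), at `z`. The sum is over
all (finitely many) multiplicative characters of `F`. -/
noncomputable def greeneHyp {F : Type*} [Field F] [Fintype F] {n : ℕ}
    (A : Fin (n + 1) → MulChar F ℂ) (B : Fin n → MulChar F ℂ) (z : F) : ℂ :=
  (Fintype.card F : ℂ) / ((Fintype.card F : ℂ) - 1) *
    ∑ᶠ χ : MulChar F ℂ,
      charBinom (A 0 * χ) χ * (∏ i : Fin n, charBinom (A i.succ * χ) (B i * χ)) * χ z

/-! ### Quadratic and quartic characters when `q ≡ 5 (mod 8)`. -/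

section QuadraticCharacter

/-! Write η for the quadratic character and χ for a quartic one, so χ² = η, η(-1) = 1 and χ(-1) =
-1. A transitive 4-tournament is an ordered 4-tuple with all forward edges. Normalising its first
two vertices to 0, 1 by an affine map gives q(q-1)/4 · N, where N counts the pairs (c, d) with χ = 1
at c, d, c-1, d-1, d-c.

On the set S of pairs for which these five elements are nonzero squares, χ is ±1, so 32 N is the sum
over S of a product of five factors 1 + χ. The symmetries of S and the oddness of χ collapse it to
|S| + 5 Σ χ(c) (`sum_squarePairs_quartic_expansion`).

Let L(c) = Σ_d η(d)η(d-1)η(d-c) and T(ψ) = Σ_c ψ(c)η(c-1)L(c). Expanding the indicators of squares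
expresses |S| and Σ χ(c) by q, the Jacobi sums J(χ,η) and J(χ⁻¹,η), T(η), T(χ) and T(χ⁻¹)
(`card_squarePairs`, `sum_squarePairs_quartic`). Here T(χ⁻¹) = T(χ) = q² ₃F₂ by orthogonality of
characters (`card_sq_mul_greeneHyp`), while a rationalising substitution gives T(η) = J(χ,η)² +
J(χ⁻¹,η)² (`twistedLegendreSum_quadratic`).

Finally J(χ,η) = a + bi has norm q, with a ≡ 1 (mod 4) and p ∤ a; these properties determine a, so x
= a. -/

theorem ringChar_ne_two_of_card_mod_eight {F : Type*} [Field F] [Fintype F]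
    (hq : Fintype.card F % 8 = 5) : ringChar F ≠ 2 := by
  intro h
  have := FiniteField.even_card_of_char_two h
  omega

variable {F : Type*} [Field F] [Fintype F] [DecidableEq F]

/-- The quadratic character of a finite field with complex values. -/
noncomputable def complexQuadraticChar (F : Type*) [Field F] [Fintype F] [DecidableEq F] :
    MulChar F ℂ :=
  (quadraticChar F).ringHomComp (Int.castRingHom ℂ)

theorem complexQuadraticChar_apply (x : F) :
    complexQuadraticChar F x = (quadraticChar F x : ℂ) := rfl

theorem complexQuadraticChar_mul_self {x : F} (hx : x ≠ 0) :
    complexQuadraticChar F x * complexQuadraticChar F x = 1 := by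
  rw [complexQuadraticChar_apply, ← sq]
  exact_mod_cast quadraticChar_sq_one hx

theorem complexQuadraticChar_eq_one_or_neg_one {x : F} (hx : x ≠ 0) :
    complexQuadraticChar F x = 1 ∨ complexQuadraticChar F x = -1 :=
  mul_self_eq_one_iff.mp (complexQuadraticChar_mul_self hx)

theorem complexQuadraticChar_eq_one_iff {x : F} :
    complexQuadraticChar F x = 1 ↔ x ≠ 0 ∧ IsSquare x := by
  rw [complexQuadraticChar_apply]
  by_cases hx : x = 0
  · simp [hx]
  · simp only [ne_eq, hx, not_false_eq_true, true_and, ← quadraticChar_one_iff_isSquare hx]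
    exact_mod_cast Iff.rfl

theorem complexQuadraticChar_inv (x : F) :
    complexQuadraticChar F x⁻¹ = complexQuadraticChar F x := by
  by_cases hx : x = 0
  · simp [hx]
  · have h : complexQuadraticChar F x⁻¹ * complexQuadraticChar F x = 1 := by
      rw [← map_mul, inv_mul_cancel₀ hx, map_one]
    have h' := complexQuadraticChar_mul_self hx
    calc _ = complexQuadraticChar F x⁻¹ *
          (complexQuadraticChar F x * complexQuadraticChar F x) := by rw [h', mul_one]
      _ = _ := by rw [← mul_assoc, h, one_mul]

theorem complexQuadraticChar_inv' : (complexQuadraticChar F)⁻¹ = complexQuadraticChar F := by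
  ext x
  rw [MulChar.inv_apply', complexQuadraticChar_inv]

theorem complexQuadraticChar_ne_one (hF : ringChar F ≠ 2) : complexQuadraticChar F ≠ 1 := by
  rw [complexQuadraticChar, MulChar.ringHomComp_ne_one_iff Int.cast_injective]
  exact quadraticChar_ne_one hF

/-- φ is 1 on nonzero squares and -1 at some z, which is then a nonsquare. A nonsquare times z is a
square, so φ is -1 at every nonsquare. In characteristic 2 everything is a square, which would force
φ = 1. -/
theorem MulChar.eq_complexQuadraticChar {φ : MulChar F ℂ} (hφ : orderOf φ = 2) :
    φ = complexQuadraticChar F := by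
  have h2 : φ ^ 2 = 1 := hφ ▸ pow_orderOf_eq_one φ
  have h1 : φ ≠ 1 := by
    rintro rfl
    simp at hφ
  have hsq : ∀ x : F, x ≠ 0 → φ x * φ x = 1 := by
    intro x hx
    rw [← MulChar.mul_apply, ← sq, h2, MulChar.one_apply hx.isUnit]
  have hodd : ringChar F ≠ 2 := by
    intro h
    apply h1
    ext x
    obtain ⟨y, hy⟩ := FiniteField.isSquare_of_char_two h (x : F)
    have hy0 : y ≠ 0 := by
      rintro rfl
      simp at hy
    rw [hy, map_mul, hsq y hy0, MulChar.one_apply (mul_ne_zero hy0 hy0).isUnit]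
  obtain ⟨z, hz⟩ := MulChar.ne_one_iff.mp h1
  have hz' : φ z = -1 := (mul_self_eq_one_iff.mp (hsq z z.ne_zero)).resolve_left hz
  have hsquare : ∀ x : F, x ≠ 0 → IsSquare x → φ x = 1 := by
    rintro x hx ⟨y, rfl⟩
    rw [map_mul, hsq y (by rintro rfl; simp at hx)]
  have hzq : quadraticChar F (z : F) = -1 := by
    rw [quadraticChar_neg_one_iff_not_isSquare]
    exact fun h => hz (hsquare z z.ne_zero h)
  ext x
  rw [complexQuadraticChar_apply]
  by_cases hs : IsSquare (x : F)
  · rw [hsquare _ x.ne_zero hs, (quadraticChar_one_iff_isSquare x.ne_zero).mpr hs, Int.cast_one]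
  · have hxq : quadraticChar F (x : F) = -1 := quadraticChar_neg_one_iff_not_isSquare.mpr hs
    have hxz : IsSquare ((x : F) * z) := by
      rw [← quadraticChar_one_iff_isSquare (mul_ne_zero x.ne_zero z.ne_zero), map_mul, hxq, hzq]
      norm_num
    have := hsquare _ (mul_ne_zero x.ne_zero z.ne_zero) hxz
    rw [map_mul, hz'] at this
    rw [hxq]
    push_cast
    linear_combination -this

theorem MulChar.sq_eq_complexQuadraticChar {χ : MulChar F ℂ} (hχ : orderOf χ = 4) :
    χ ^ 2 = complexQuadraticChar F :=
  MulChar.eq_complexQuadraticChar (by rw [orderOf_pow' χ two_ne_zero, hχ]; rfl)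

theorem complexQuadraticChar_neg_one (hq : Fintype.card F % 8 = 5) :
    complexQuadraticChar F (-1) = 1 :=
  complexQuadraticChar_eq_one_iff.mpr
    ⟨neg_ne_zero.mpr one_ne_zero, FiniteField.isSquare_neg_one_iff.mpr (by omega)⟩

theorem complexQuadraticChar_sub_comm (hq : Fintype.card F % 8 = 5) (x y : F) :
    complexQuadraticChar F (x - y) = complexQuadraticChar F (y - x) := by
  rw [← neg_sub, ← neg_one_mul, map_mul, complexQuadraticChar_neg_one hq, one_mul]

variable {χ : MulChar F ℂ}

theorem MulChar.apply_mul_self_of_sq_eq (hχ : χ ^ 2 = complexQuadraticChar F) (x : F) :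
    χ x * χ x = complexQuadraticChar F x := by
  rw [← hχ, sq, MulChar.mul_apply]

/-- A quartic character takes the value `1` exactly at the nonzero fourth powers. -/
theorem MulChar.apply_eq_one_iff_exists_pow_four (hχ : χ ^ 2 = complexQuadraticChar F) {x : F} :
    χ x = 1 ↔ ∃ z : F, z ≠ 0 ∧ z ^ 4 = x := by
  constructor
  · intro h
    have hx : complexQuadraticChar F x = 1 := by
      rw [← MulChar.apply_mul_self_of_sq_eq hχ, h, one_mul]
    obtain ⟨hx0, y, rfl⟩ := complexQuadraticChar_eq_one_iff.mp hx
    rw [map_mul, MulChar.apply_mul_self_of_sq_eq hχ] at h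
    obtain ⟨hy0, z, rfl⟩ := complexQuadraticChar_eq_one_iff.mp h
    exact ⟨z, by rintro rfl; simp at hy0, by ring⟩
  · rintro ⟨z, hz, rfl⟩
    have h1 := complexQuadraticChar_mul_self hz
    rw [← MulChar.apply_mul_self_of_sq_eq hχ] at h1
    rw [map_pow]
    linear_combination h1

/-- If -1 were a fourth power z⁴, then z would have order 8, but 8 does not divide q - 1. -/
theorem MulChar.quartic_neg_one (hq : Fintype.card F % 8 = 5)
    (hχ : χ ^ 2 = complexQuadraticChar F) : χ (-1) = -1 := by
  have h : χ (-1) * χ (-1) = 1 := by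
    rw [MulChar.apply_mul_self_of_sq_eq hχ, complexQuadraticChar_neg_one hq]
  refine (mul_self_eq_one_iff.mp h).resolve_left fun h1 => ?_
  obtain ⟨z, hz, hz4⟩ := (MulChar.apply_eq_one_iff_exists_pow_four hχ).mp h1
  have h8 : z ^ 8 = 1 := by linear_combination (z ^ 4 - 1) * hz4
  have h4 : z ^ 4 ≠ 1 := by
    rw [hz4]
    exact Ring.neg_one_ne_one_of_char_ne_two (ringChar_ne_two_of_card_mod_eight hq)
  have ho : orderOf z = 2 ^ 3 :=
    orderOf_eq_prime_pow (p := 2) (n := 2) (by simpa using h4) (by simpa using h8)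
  have hd : orderOf z ∣ Fintype.card F - 1 :=
    orderOf_dvd_of_pow_eq_one (FiniteField.pow_card_sub_one_eq_one z hz)
  rw [ho] at hd
  omega

theorem MulChar.quartic_sub_comm (hq : Fintype.card F % 8 = 5)
    (hχ : χ ^ 2 = complexQuadraticChar F) (x y : F) : χ (x - y) = -χ (y - x) := by
  rw [← neg_sub, ← neg_one_mul, map_mul, MulChar.quartic_neg_one hq hχ, neg_one_mul]

end QuadraticCharacter

/-! ### Transitive subtournaments as ordered tuples, and affine normalisation. -/

section TransitiveTournaments

variable {V : Type*}

/-- The transitive tournament on the values of `v` with an edge from each value to all later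
ones. -/
def DiSubgraph.ofTuple {m : ℕ} {G : Digraph V} (v : Fin m → V)
    (hv : ∀ i j, i < j → G.Adj (v i) (v j)) : DiSubgraph G where
  verts := Set.range v
  Adj a b := ∃ i j, i < j ∧ v i = a ∧ v j = b
  adj_sub := by
    rintro a b ⟨i, j, hij, rfl, rfl⟩
    exact hv i j hij
  left_mem := by
    rintro a b ⟨i, j, hij, rfl, rfl⟩
    exact Set.mem_range_self i
  right_mem := by
    rintro a b ⟨i, j, hij, rfl, rfl⟩
    exact Set.mem_range_self j

theorem injective_of_forall_lt_adj {m : ℕ} {G : Digraph V} (hG : ∀ a, ¬ G.Adj a a)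
    {v : Fin m → V} (hv : ∀ i j, i < j → G.Adj (v i) (v j)) : Function.Injective v := by
  intro i j hij
  by_contra hne
  rcases lt_or_gt_of_ne hne with h | h
  · exact hG _ (hij ▸ hv i j h)
  · exact hG _ (hij ▸ hv j i h)

/-- The edges recover the order of the vertices: two such enumerations differ by a strictly monotone
self-map of `Fin m`, which is the identity. -/
theorem DiSubgraph.eq_of_ofTuple_eq {m : ℕ} {G : Digraph V} (hG : ∀ a, ¬ G.Adj a a)
    {v w : Fin m → V} (hv : ∀ i j, i < j → G.Adj (v i) (v j))
    (hw : ∀ i j, i < j → G.Adj (w i) (w j))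
    (h : DiSubgraph.ofTuple v hv = DiSubgraph.ofTuple w hw) : v = w := by
  have hwi := injective_of_forall_lt_adj hG hw
  have hverts : Set.range v = Set.range w := congrArg DiSubgraph.verts h
  have hσ : ∀ i, ∃ j, w j = v i := fun i => by
    have : v i ∈ Set.range w := hverts ▸ Set.mem_range_self i
    exact this
  choose σ hσ using hσ
  have hmono : StrictMono σ := by
    intro i j hij
    have hadj : (DiSubgraph.ofTuple w hw).Adj (v i) (v j) := by
      rw [← h]
      exact ⟨i, j, hij, rfl, rfl⟩
    obtain ⟨k, l, hkl, hk, hl⟩ := hadj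
    rw [← hσ] at hk hl
    rwa [hwi hk, hwi hl] at hkl
  have hid : σ = id := by
    rw [← hmono.range_inj strictMono_id,
      (Finite.surjective_of_injective hmono.injective).range_eq, Set.range_id]
  funext i
  rw [← hσ, hid, id]

theorem DiSubgraph.ofTuple_isTournament {m : ℕ} {G : Digraph V} (hG : ∀ a, ¬ G.Adj a a)
    {v : Fin m → V} (hv : ∀ i j, i < j → G.Adj (v i) (v j)) :
    (DiSubgraph.ofTuple v hv).IsTournament := by
  have hvi := injective_of_forall_lt_adj hG hv
  refine ⟨fun a ha => hG a ((DiSubgraph.ofTuple v hv).adj_sub ha), ?_⟩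
  rintro _ ⟨i, rfl⟩ _ ⟨j, rfl⟩ hij
  have key : ∀ k l, (DiSubgraph.ofTuple v hv).Adj (v k) (v l) ↔ k < l := by
    intro k l
    constructor
    · rintro ⟨k', l', hkl, hk, hl⟩
      rwa [hvi hk, hvi hl] at hkl
    · exact fun hkl => ⟨k, l, hkl, rfl, rfl⟩
  rw [key, key]
  rcases lt_or_gt_of_ne (fun h => hij (congrArg v h) : i ≠ j) with h | h
  · exact Or.inl ⟨h, h.asymm⟩
  · exact Or.inr ⟨h, h.asymm⟩

theorem DiSubgraph.ofTuple_isTransitive {m : ℕ} {G : Digraph V} (hG : ∀ a, ¬ G.Adj a a)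
    {v : Fin m → V} (hv : ∀ i j, i < j → G.Adj (v i) (v j)) :
    (DiSubgraph.ofTuple v hv).IsTransitive := by
  have hvi := injective_of_forall_lt_adj hG hv
  rintro a b c ⟨i, j, hij, rfl, rfl⟩ ⟨k, l, hkl, hk, rfl⟩
  exact ⟨i, l, hij.trans (hvi hk ▸ hkl), rfl, rfl⟩

theorem DiSubgraph.exists_ofTuple_eq {m : ℕ} (hm : m ≠ 0) {G : Digraph V} (T : DiSubgraph G)
    (hcard : T.verts.ncard = m) (htour : T.IsTournament) (htrans : T.IsTransitive) :
    ∃ (v : Fin m → V) (hv : ∀ i j, i < j → G.Adj (v i) (v j)), DiSubgraph.ofTuple v hv = T := by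
  classical
  -- `ncard` is 0 on infinite sets, so `m ≠ 0` is what yields finiteness.
  have hfin : T.verts.Finite := Set.finite_of_ncard_ne_zero (hcard ▸ hm)
  have : Fintype T.verts := hfin.fintype
  let r : T.verts → T.verts → Prop := fun a b => T.Adj a b
  have hr : IsStrictTotalOrder T.verts r :=
    { trichotomous := by
        intro a b hab hba
        by_contra hne
        rcases htour.2 a a.2 b b.2 (fun h => hne (Subtype.ext h)) with h | h
        · exact hab h.1
        · exact hba h.1
      irrefl := fun a => htour.1 a
      trans := fun a b c => htrans a b c }
  let : LinearOrder T.verts := linearOrderOfSTO r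
  have hc : Fintype.card T.verts = m := by
    rw [← hcard, ← Nat.card_coe_set_eq, Nat.card_eq_fintype_card]
  let e : Fin m ≃o T.verts := Fintype.orderIsoFinOfCardEq T.verts hc
  have hlt : ∀ i j, i < j ↔ T.Adj (e i) (e j) := fun i j => (e.lt_iff_lt (x := i) (y := j)).symm
  refine ⟨fun i => e i, fun i j hij => T.adj_sub ((hlt i j).mp hij), ?_⟩
  ext a b
  · constructor
    · rintro ⟨i, rfl⟩
      exact (e i).2
    · intro ha
      exact ⟨e.symm ⟨a, ha⟩, by simp⟩
  · constructor
    · rintro ⟨i, j, hij, rfl, rfl⟩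
      exact (hlt i j).mp hij
    · intro hab
      refine ⟨e.symm ⟨a, T.left_mem hab⟩, e.symm ⟨b, T.right_mem hab⟩, ?_, by simp, by simp⟩
      rw [hlt]
      simpa using hab

/-- Transitive subtournaments of a loopless digraph correspond to tuples of vertices in which
every vertex is joined to all later ones. -/
theorem transSubtournamentCount_eq_card_tuples {m : ℕ} (hm : m ≠ 0) {G : Digraph V}
    (hG : ∀ a, ¬ G.Adj a a) :
    transSubtournamentCount m G =
      Nat.card {v : Fin m → V // ∀ i j, i < j → G.Adj (v i) (v j)} := by
  symm
  refine Nat.card_congr (Equiv.ofBijective (fun v => ⟨DiSubgraph.ofTuple v.1 v.2, ?_,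
    DiSubgraph.ofTuple_isTournament hG v.2, DiSubgraph.ofTuple_isTransitive hG v.2⟩) ⟨?_, ?_⟩)
  · change (Set.range v.1).ncard = m
    rw [← Nat.card_coe_set_eq, Nat.card_range_of_injective (injective_of_forall_lt_adj hG v.2),
      Nat.card_fin]
  · intro v w h
    exact Subtype.ext (DiSubgraph.eq_of_ofTuple_eq hG v.2 w.2 (congrArg Subtype.val h))
  · rintro ⟨T, hT, htour, htrans⟩
    obtain ⟨v, hv, h⟩ := DiSubgraph.exists_ofTuple_eq hm T hT htour htrans
    exact ⟨⟨v, hv⟩, Subtype.ext h⟩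

variable {F : Type*} [Field F]

theorem paleyDigraph_loopless (k : ℕ) (a : F) : ¬ (paleyDigraph F k).Adj a a := by
  rintro ⟨s, -, hs⟩
  rw [sub_self] at hs
  exact s.ne_zero hs

/-- The pairs completing `0, 1` to a transitive tournament on four vertices. -/
abbrev QuarticPairs (F : Type*) [Field F] : Type _ :=
  {x : F × F // (paleyDigraph F 4).Adj 0 x.1 ∧ (paleyDigraph F 4).Adj 0 x.2 ∧
    (paleyDigraph F 4).Adj 1 x.1 ∧ (paleyDigraph F 4).Adj 1 x.2 ∧
    (paleyDigraph F 4).Adj x.1 x.2}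

theorem paleyDigraph_adj_affine {k : ℕ} (a : F) {s : Fˣ} (hs : s ∈ kthPowerResidues F k)
    (x y : F) : (paleyDigraph F k).Adj (a + s * x) (a + s * y) ↔ (paleyDigraph F k).Adj x y := by
  constructor
  · rintro ⟨t, ht, h⟩
    refine ⟨s⁻¹ * t, mul_mem (inv_mem hs) ht, ?_⟩
    rw [Units.val_mul, h]
    have := s.inv_mul
    linear_combination (y - x) * this
  · rintro ⟨t, ht, h⟩
    refine ⟨s * t, mul_mem hs ht, ?_⟩
    rw [Units.val_mul, h]
    ring

/-- The affine maps `x ↦ a + s x` with `s` a fourth power act freely on the transitive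
tournaments, and every orbit has exactly one member starting with `0, 1`. -/
noncomputable def affineNormalForm (F : Type*) [Field F] :
    (F × kthPowerResidues F 4 × QuarticPairs F) ≃
      {v : Fin 4 → F // ∀ i j, i < j → (paleyDigraph F 4).Adj (v i) (v j)} := by
  have h01 : (paleyDigraph F 4).Adj 0 1 := ⟨1, one_mem _, by simp⟩
  refine Equiv.ofBijective (fun x => ⟨fun i => x.1 + (x.2.1 : Fˣ) *
    (![0, 1, x.2.2.1.1, x.2.2.1.2] : Fin 4 → F) i, ?_⟩) ⟨?_, ?_⟩
  · obtain ⟨a, ⟨s, hs⟩, ⟨⟨c, d⟩, h1, h2, h3, h4, h5⟩⟩ := x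
    intro i j hij
    rw [paleyDigraph_adj_affine a hs]
    fin_cases i <;> fin_cases j <;> first | assumption | (exfalso; revert hij; decide)
  · rintro ⟨a, ⟨s, hs⟩, ⟨⟨c, d⟩, h⟩⟩ ⟨a', ⟨s', hs'⟩, ⟨⟨c', d'⟩, h'⟩⟩ heq
    have heq' := congrArg Subtype.val heq
    have e0 := congrFun heq' 0
    have e1 := congrFun heq' 1
    have e2 := congrFun heq' 2
    have e3 := congrFun heq' 3
    simp at e0 e1 e2 e3
    subst e0
    have es : s = s' := Units.ext (add_left_cancel e1)
    subst es
    have ec : c = c' := by simpa using e2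
    have ed : d = d' := by simpa using e3
    subst ec ed
    rfl
  · rintro ⟨v, hv⟩
    -- The translation `v 0` and the scale `s = v 1 - v 0` are forced by sending 0, 1 to the first
    -- two vertices.
    obtain ⟨s, hs, hs'⟩ := hv 0 1 (by decide)
    have e0 : v 0 = v 0 + s * 0 := by ring
    have e1 : v 1 = v 0 + s * 1 := by rw [hs']; ring
    have e2 : v 2 = v 0 + s * ((s⁻¹ : Fˣ) * (v 2 - v 0)) := by
      rw [Units.mul_inv_cancel_left]; ring
    have e3 : v 3 = v 0 + s * ((s⁻¹ : Fˣ) * (v 3 - v 0)) := by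
      rw [Units.mul_inv_cancel_left]; ring
    refine ⟨⟨v 0, ⟨s, hs⟩, ⟨⟨(s⁻¹ : Fˣ) * (v 2 - v 0), (s⁻¹ : Fˣ) * (v 3 - v 0)⟩,
      ?_, ?_, ?_, ?_, ?_⟩⟩, Subtype.ext (funext fun i => ?_)⟩
    · rw [← paleyDigraph_adj_affine (v 0) hs, ← e0, ← e2]; exact hv 0 2 (by decide)
    · rw [← paleyDigraph_adj_affine (v 0) hs, ← e0, ← e3]; exact hv 0 3 (by decide)
    · rw [← paleyDigraph_adj_affine (v 0) hs, ← e1, ← e2]; exact hv 1 2 (by decide)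
    · rw [← paleyDigraph_adj_affine (v 0) hs, ← e1, ← e3]; exact hv 1 3 (by decide)
    · rw [← paleyDigraph_adj_affine (v 0) hs, ← e2, ← e3]; exact hv 2 3 (by decide)
    · fin_cases i
      · exact e0.symm
      · exact e1.symm
      · exact e2.symm
      · exact e3.symm

theorem card_kthPowerResidues_four [Fintype F] (hq : Fintype.card F % 4 = 1) :
    4 * Nat.card (kthPowerResidues F 4) = Fintype.card F - 1 := by
  classical
  have h : Nat.card Fˣ = Fintype.card F - 1 := by
    rw [Nat.card_eq_fintype_card, Fintype.card_units]
  have hd : 4 ∣ Fintype.card F - 1 := by omega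
  rw [kthPowerResidues, IsCyclic.card_powMonoidHom_range, h, Nat.gcd_eq_right hd,
    Nat.mul_div_cancel' hd]

theorem four_mul_transSubtournamentCount_paleyDigraph [Fintype F] (hq : Fintype.card F % 4 = 1) :
    4 * transSubtournamentCount 4 (paleyDigraph F 4) =
      Fintype.card F * (Fintype.card F - 1) * Nat.card (QuarticPairs F) := by
  rw [transSubtournamentCount_eq_card_tuples four_ne_zero (paleyDigraph_loopless 4),
    ← Nat.card_congr (affineNormalForm F), Nat.card_prod, Nat.card_prod,
    ← card_kthPowerResidues_four hq, Nat.card_eq_fintype_card (α := F)]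
  ring

end TransitiveTournaments

/-! ### Reduction of the quartic count to sums over cliques of the Paley graph. -/

section SquarePairs

variable {F : Type*} [Field F] [Fintype F] [DecidableEq F]

open Classical in
/-- The pairs completing `0, 1` to a clique on four vertices of the Paley graph. -/
noncomputable def squarePairs (F : Type*) [Field F] [Fintype F] [DecidableEq F] :
    Finset (F × F) :=
  Finset.univ.filter fun x => complexQuadraticChar F x.1 = 1 ∧ complexQuadraticChar F x.2 = 1 ∧
    complexQuadraticChar F (x.1 - 1) = 1 ∧ complexQuadraticChar F (x.2 - 1) = 1 ∧
    complexQuadraticChar F (x.1 - x.2) = 1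

theorem mem_squarePairs {c d : F} : (c, d) ∈ squarePairs F ↔
    complexQuadraticChar F c = 1 ∧ complexQuadraticChar F d = 1 ∧
    complexQuadraticChar F (c - 1) = 1 ∧ complexQuadraticChar F (d - 1) = 1 ∧
    complexQuadraticChar F (c - d) = 1 := by
  simp [squarePairs]

theorem ne_zero_of_complexQuadraticChar_eq_one {x : F} (h : complexQuadraticChar F x = 1) :
    x ≠ 0 :=
  (complexQuadraticChar_eq_one_iff.mp h).1

/-- Membership says that all differences among 0, 1, c, d are nonzero squares. Since η(-1) = 1, this
survives exchanging c and d, exchanging 0 and 1, exchanging 1 and c after rescaling, and inversion;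
these are the four symmetries used below. -/
theorem sum_squarePairs_swap (hq : Fintype.card F % 8 = 5) (f : F → F → ℂ) :
    ∑ x ∈ squarePairs F, f x.2 x.1 = ∑ x ∈ squarePairs F, f x.1 x.2 := by
  have h : ∀ x ∈ squarePairs F, x.swap ∈ squarePairs F := by
    rintro ⟨c, d⟩ hx
    obtain ⟨h1, h2, h3, h4, h5⟩ := mem_squarePairs.mp hx
    exact mem_squarePairs.mpr ⟨h2, h1, h4, h3, by rwa [complexQuadraticChar_sub_comm hq]⟩
  exact Finset.sum_nbij' Prod.swap Prod.swap h h (fun x _ => x.swap_swap)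
    (fun x _ => x.swap_swap) (fun x _ => rfl)

theorem sum_squarePairs_one_sub (hq : Fintype.card F % 8 = 5) (f : F → F → ℂ) :
    ∑ x ∈ squarePairs F, f (1 - x.1) (1 - x.2) = ∑ x ∈ squarePairs F, f x.1 x.2 := by
  have h : ∀ x ∈ squarePairs F, ((1 - x.1, 1 - x.2) : F × F) ∈ squarePairs F := by
    rintro ⟨c, d⟩ hx
    obtain ⟨h1, h2, h3, h4, h5⟩ := mem_squarePairs.mp hx
    refine mem_squarePairs.mpr ⟨by rwa [complexQuadraticChar_sub_comm hq],
      by rwa [complexQuadraticChar_sub_comm hq], ?_, ?_, ?_⟩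
    · rwa [sub_right_comm, sub_self, complexQuadraticChar_sub_comm hq, sub_zero]
    · rwa [sub_right_comm, sub_self, complexQuadraticChar_sub_comm hq, sub_zero]
    · rwa [sub_sub_sub_cancel_left, complexQuadraticChar_sub_comm hq]
  exact Finset.sum_nbij' (fun x => (1 - x.1, 1 - x.2)) (fun x => (1 - x.1, 1 - x.2)) h h
    (fun x _ => by simp) (fun x _ => by simp) (fun x _ => rfl)

theorem sum_squarePairs_div_left (hq : Fintype.card F % 8 = 5) (f : F → F → ℂ) :
    ∑ x ∈ squarePairs F, f x.1⁻¹ (x.2 * x.1⁻¹) = ∑ x ∈ squarePairs F, f x.1 x.2 := by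
  have h : ∀ x ∈ squarePairs F, ((x.1⁻¹, x.2 * x.1⁻¹) : F × F) ∈ squarePairs F := by
    rintro ⟨c, d⟩ hx
    obtain ⟨h1, h2, h3, h4, h5⟩ := mem_squarePairs.mp hx
    have hc := ne_zero_of_complexQuadraticChar_eq_one h1
    have h1' : complexQuadraticChar F c⁻¹ = 1 := by rw [complexQuadraticChar_inv, h1]
    refine mem_squarePairs.mpr ⟨h1', by rw [map_mul, h2, h1', one_mul], ?_, ?_, ?_⟩
    · rw [show c⁻¹ - 1 = (1 - c) * c⁻¹ by field_simp, map_mul,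
        complexQuadraticChar_sub_comm hq, h3, h1', one_mul]
    · rw [show d * c⁻¹ - 1 = (d - c) * c⁻¹ by field_simp, map_mul,
        complexQuadraticChar_sub_comm hq, h5, h1', one_mul]
    · rw [show c⁻¹ - d * c⁻¹ = (1 - d) * c⁻¹ by field_simp, map_mul,
        complexQuadraticChar_sub_comm hq, h4, h1', one_mul]
  have h' : ∀ x ∈ squarePairs F, (((x.1⁻¹)⁻¹, x.2 * x.1⁻¹ * (x.1⁻¹)⁻¹) : F × F) = x := by
    rintro ⟨c, d⟩ hx
    have hc := ne_zero_of_complexQuadraticChar_eq_one (mem_squarePairs.mp hx).1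
    simp [hc]
  exact Finset.sum_nbij' (fun x => (x.1⁻¹, x.2 * x.1⁻¹)) (fun x => (x.1⁻¹, x.2 * x.1⁻¹)) h h
    h' h' (fun x _ => rfl)

theorem sum_squarePairs_inv (hq : Fintype.card F % 8 = 5) (f : F → F → ℂ) :
    ∑ x ∈ squarePairs F, f x.1⁻¹ x.2⁻¹ = ∑ x ∈ squarePairs F, f x.1 x.2 := by
  have h : ∀ x ∈ squarePairs F, ((x.1⁻¹, x.2⁻¹) : F × F) ∈ squarePairs F := by
    rintro ⟨c, d⟩ hx
    obtain ⟨h1, h2, h3, h4, h5⟩ := mem_squarePairs.mp hx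
    have hc := ne_zero_of_complexQuadraticChar_eq_one h1
    have hd := ne_zero_of_complexQuadraticChar_eq_one h2
    have h1' : complexQuadraticChar F c⁻¹ = 1 := by rw [complexQuadraticChar_inv, h1]
    have h2' : complexQuadraticChar F d⁻¹ = 1 := by rw [complexQuadraticChar_inv, h2]
    refine mem_squarePairs.mpr ⟨h1', h2', ?_, ?_, ?_⟩
    · rw [show c⁻¹ - 1 = (1 - c) * c⁻¹ by field_simp, map_mul,
        complexQuadraticChar_sub_comm hq, h3, h1', one_mul]
    · rw [show d⁻¹ - 1 = (1 - d) * d⁻¹ by field_simp, map_mul,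
        complexQuadraticChar_sub_comm hq, h4, h2', one_mul]
    · rw [show c⁻¹ - d⁻¹ = (d - c) * c⁻¹ * d⁻¹ by field_simp, map_mul, map_mul,
        complexQuadraticChar_sub_comm hq, h5, h1', h2', one_mul, one_mul]
  exact Finset.sum_nbij' (fun x => (x.1⁻¹, x.2⁻¹)) (fun x => (x.1⁻¹, x.2⁻¹)) h h
    (fun x _ => by simp) (fun x _ => by simp) (fun x _ => rfl)

variable {χ : MulChar F ℂ}

theorem MulChar.quartic_apply_mul_self_eq_one (hχ : χ ^ 2 = complexQuadraticChar F) {x : F}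
    (hx : complexQuadraticChar F x = 1) : χ x * χ x = 1 := by
  rw [MulChar.apply_mul_self_of_sq_eq hχ, hx]

theorem MulChar.quartic_inv (hχ : χ ^ 2 = complexQuadraticChar F) {x : F}
    (hx : complexQuadraticChar F x = 1) : χ x⁻¹ = χ x := by
  have h1 := MulChar.quartic_apply_mul_self_eq_one hχ hx
  have h2 : χ x⁻¹ * χ x = 1 := by
    rw [← map_mul, inv_mul_cancel₀ (ne_zero_of_complexQuadraticChar_eq_one hx), map_one]
  linear_combination χ x * h2 - χ x⁻¹ * h1

theorem MulChar.quartic_inv_sub_one (hq : Fintype.card F % 8 = 5)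
    (hχ : χ ^ 2 = complexQuadraticChar F) {x : F} (hx : complexQuadraticChar F x = 1) :
    χ (x⁻¹ - 1) = -(χ (x - 1) * χ x) := by
  have := ne_zero_of_complexQuadraticChar_eq_one hx
  rw [show x⁻¹ - 1 = (1 - x) * x⁻¹ by field_simp, map_mul, MulChar.quartic_inv hχ hx,
    MulChar.quartic_sub_comm hq hχ, neg_mul]

/-- Of the 16 monomials without χ(d-c), the constant gives |S|. The single factors cancel, as χ(c-1)
sums to minus the sum of χ(c). Four of the six double products and the quadruple product each give Σ
χ(c), and everything else vanishes or cancels. -/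
theorem sum_squarePairs_quartic_expansion (hq : Fintype.card F % 8 = 5)
    (hχ : χ ^ 2 = complexQuadraticChar F) :
    ∑ x ∈ squarePairs F, (1 + χ x.1) * (1 + χ x.2) * (1 + χ (x.1 - 1)) * (1 + χ (x.2 - 1)) *
        (1 + χ (x.2 - x.1)) =
      (squarePairs F).card + 5 * ∑ x ∈ squarePairs F, χ x.1 := by
  have swap := sum_squarePairs_swap hq
  have refl := sum_squarePairs_one_sub hq
  have scale := sum_squarePairs_div_left hq
  have hneg : ∀ x : F, χ (1 - x) = -χ (x - 1) := fun x => MulChar.quartic_sub_comm hq hχ 1 x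
  have hneg' : ∀ x : F, χ (1 - x - 1) = -χ x := fun x => by
    rw [MulChar.quartic_sub_comm hq hχ]; congr 2; ring
  have hb : ∑ x ∈ squarePairs F, χ x.2 = ∑ x ∈ squarePairs F, χ x.1 := swap fun c _ => χ c
  have ha1 : ∑ x ∈ squarePairs F, χ (x.1 - 1) = -∑ x ∈ squarePairs F, χ x.1 := by
    rw [← refl fun c _ => χ c]
    simp [hneg]
  have hb1 : ∑ x ∈ squarePairs F, χ (x.2 - 1) = -∑ x ∈ squarePairs F, χ x.1 := by
    rw [← ha1]; exact swap fun c _ => χ (c - 1)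
  have hab : ∑ x ∈ squarePairs F, χ x.1 * χ x.2 = ∑ x ∈ squarePairs F, χ x.1 := by
    rw [← hb, ← scale fun c d => χ c * χ d]
    refine Finset.sum_congr rfl fun ⟨c, d⟩ hx => ?_
    obtain ⟨h1, h2, h3, h4, h5⟩ := mem_squarePairs.mp hx
    dsimp only
    rw [map_mul, MulChar.quartic_inv hχ h1]
    linear_combination χ d * MulChar.quartic_apply_mul_self_eq_one hχ h1
  have ha1b1 : ∑ x ∈ squarePairs F, χ (x.1 - 1) * χ (x.2 - 1) = ∑ x ∈ squarePairs F, χ x.1 := by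
    rw [← hab, ← refl fun c d => χ c * χ d]
    simp [hneg]
  have haa1 : ∑ x ∈ squarePairs F, χ x.1 * χ (x.1 - 1) = ∑ x ∈ squarePairs F, χ x.1 := by
    rw [← neg_eq_iff_eq_neg.mpr ha1, ← Finset.sum_neg_distrib, ← scale fun c d => χ c * χ (c - 1)]
    refine Finset.sum_congr rfl fun ⟨c, d⟩ hx => ?_
    obtain ⟨h1, h2, h3, h4, h5⟩ := mem_squarePairs.mp hx
    dsimp only
    rw [MulChar.quartic_inv_sub_one hq hχ h1, MulChar.quartic_inv hχ h1]
    linear_combination -χ (c - 1) * MulChar.quartic_apply_mul_self_eq_one hχ h1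
  have hbb1 : ∑ x ∈ squarePairs F, χ x.2 * χ (x.2 - 1) = ∑ x ∈ squarePairs F, χ x.1 := by
    rw [← haa1]; exact swap fun c _ => χ c * χ (c - 1)
  -- Rescaling turns this sum into its own negative.
  have ha1b : ∑ x ∈ squarePairs F, χ (x.1 - 1) * χ x.2 = 0 := by
    rw [← self_eq_neg, ← Finset.sum_neg_distrib, ← scale fun c d => χ (c - 1) * χ d]
    refine Finset.sum_congr rfl fun ⟨c, d⟩ hx => ?_
    obtain ⟨h1, h2, h3, h4, h5⟩ := mem_squarePairs.mp hx
    dsimp only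
    rw [MulChar.quartic_inv_sub_one hq hχ h1, map_mul, MulChar.quartic_inv hχ h1]
    linear_combination -χ (c - 1) * χ d * MulChar.quartic_apply_mul_self_eq_one hχ h1
  have hab1 : ∑ x ∈ squarePairs F, χ x.1 * χ (x.2 - 1) = 0 := by
    rw [← ha1b, ← swap fun c d => χ (c - 1) * χ d]
    exact Finset.sum_congr rfl fun x _ => mul_comm _ _
  -- Up to swapping, the triple products form two sums that `c ↦ 1 - c`, `d ↦ 1 - d` makes opposite,
  -- so they cancel without being evaluated.
  have haa1b : ∑ x ∈ squarePairs F, χ x.1 * χ (x.1 - 1) * χ x.2 =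
      -∑ x ∈ squarePairs F, χ x.1 * χ (x.1 - 1) * χ (x.2 - 1) := by
    rw [← refl fun c d => χ c * χ (c - 1) * χ d, ← Finset.sum_neg_distrib]
    refine Finset.sum_congr rfl fun x _ => ?_
    rw [hneg, hneg, hneg']
    ring
  have habb1 : ∑ x ∈ squarePairs F, χ x.1 * χ x.2 * χ (x.2 - 1) =
      ∑ x ∈ squarePairs F, χ x.1 * χ (x.1 - 1) * χ x.2 := by
    rw [← swap fun c d => χ c * χ (c - 1) * χ d]
    exact Finset.sum_congr rfl fun x _ => by ring
  have ha1bb1 : ∑ x ∈ squarePairs F, χ (x.1 - 1) * χ x.2 * χ (x.2 - 1) =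
      ∑ x ∈ squarePairs F, χ x.1 * χ (x.1 - 1) * χ (x.2 - 1) := by
    rw [← swap fun c d => χ c * χ (c - 1) * χ (d - 1)]
    exact Finset.sum_congr rfl fun x _ => by ring
  have haa1bb1 : ∑ x ∈ squarePairs F, χ x.1 * χ (x.1 - 1) * χ x.2 * χ (x.2 - 1) =
      ∑ x ∈ squarePairs F, χ x.1 := by
    rw [← ha1b1,
      ← sum_squarePairs_inv hq fun c d => χ c * χ (c - 1) * χ d * χ (d - 1)]
    refine Finset.sum_congr rfl fun ⟨c, d⟩ hx => ?_
    obtain ⟨h1, h2, h3, h4, h5⟩ := mem_squarePairs.mp hx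
    dsimp only
    rw [MulChar.quartic_inv_sub_one hq hχ h1, MulChar.quartic_inv_sub_one hq hχ h2,
      MulChar.quartic_inv hχ h1, MulChar.quartic_inv hχ h2]
    linear_combination χ (c - 1) * χ (d - 1) * χ d * χ d *
      MulChar.quartic_apply_mul_self_eq_one hχ h1 +
      χ (c - 1) * χ (d - 1) * MulChar.quartic_apply_mul_self_eq_one hχ h2
  -- Swapping negates χ(d-c) and fixes the other four factors as a whole.
  have hskew : ∑ x ∈ squarePairs F, (1 + χ x.1) * (1 + χ x.2) * (1 + χ (x.1 - 1)) *
      (1 + χ (x.2 - 1)) * χ (x.2 - x.1) = 0 := by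
    rw [← self_eq_neg, ← Finset.sum_neg_distrib, ← swap fun c d => (1 + χ c) * (1 + χ d) *
      (1 + χ (c - 1)) * (1 + χ (d - 1)) * χ (d - c)]
    refine Finset.sum_congr rfl fun x _ => ?_
    rw [MulChar.quartic_sub_comm hq hχ x.1 x.2]
    ring
  have hsum : ∑ x ∈ squarePairs F, (1 + χ x.1) * (1 + χ x.2) * (1 + χ (x.1 - 1)) *
      (1 + χ (x.2 - 1)) * (1 + χ (x.2 - x.1)) = ∑ x ∈ squarePairs F,
      ((1 + χ x.1) * (1 + χ x.2) * (1 + χ (x.1 - 1)) * (1 + χ (x.2 - 1)) * χ (x.2 - x.1) +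
      1 + χ x.1 + χ x.2 + χ (x.1 - 1) + χ (x.2 - 1) + χ x.1 * χ x.2 +
      χ (x.1 - 1) * χ (x.2 - 1) + χ x.1 * χ (x.1 - 1) + χ x.2 * χ (x.2 - 1) +
      χ (x.1 - 1) * χ x.2 + χ x.1 * χ (x.2 - 1) + χ x.1 * χ (x.1 - 1) * χ x.2 +
      χ x.1 * χ (x.1 - 1) * χ (x.2 - 1) + χ x.1 * χ x.2 * χ (x.2 - 1) +
      χ (x.1 - 1) * χ x.2 * χ (x.2 - 1) + χ x.1 * χ (x.1 - 1) * χ x.2 * χ (x.2 - 1)) :=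
    Finset.sum_congr rfl fun x _ => by ring
  rw [hsum]
  simp only [Finset.sum_add_distrib]
  rw [hskew, hb, ha1, hb1, hab, ha1b1, haa1, hbb1, ha1b, hab1, habb1, ha1bb1, haa1b, haa1bb1]
  simp only [Finset.sum_const, nsmul_eq_mul]
  ring

theorem paleyDigraph_four_adj_iff (hχ : χ ^ 2 = complexQuadraticChar F) {x y : F} :
    (paleyDigraph F 4).Adj x y ↔ χ (y - x) = 1 := by
  rw [MulChar.apply_eq_one_iff_exists_pow_four hχ]
  constructor
  · rintro ⟨_, ⟨z, rfl⟩, h⟩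
    exact ⟨z, z.ne_zero, by rw [← h]; simp⟩
  · rintro ⟨z, hz, h⟩
    exact ⟨Units.mk0 z hz ^ 4, ⟨Units.mk0 z hz, rfl⟩, by rw [← h]; simp⟩

/-- On `squarePairs` each χ value is ±1, so 1 + χ is twice the indicator of χ = 1; five conditions
give 2⁵. No pair is lost, since χ = 1 implies η = 1. -/
theorem card_quarticPairs (hq : Fintype.card F % 8 = 5) (hχ : χ ^ 2 = complexQuadraticChar F) :
    32 * (Nat.card (QuarticPairs F) : ℂ) =
      (squarePairs F).card + 5 * ∑ x ∈ squarePairs F, χ x.1 := by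
  classical
  rw [← sum_squarePairs_quartic_expansion hq hχ]
  have hcard : Nat.card (QuarticPairs F) = ((squarePairs F).filter fun x => χ x.1 = 1 ∧
      χ x.2 = 1 ∧ χ (x.1 - 1) = 1 ∧ χ (x.2 - 1) = 1 ∧ χ (x.2 - x.1) = 1).card := by
    rw [QuarticPairs, Nat.card_eq_fintype_card, Fintype.card_subtype]
    congr 1
    ext ⟨c, d⟩
    have hη : ∀ {x : F}, χ x = 1 → complexQuadraticChar F x = 1 := fun {x} h => by
      rw [← MulChar.apply_mul_self_of_sq_eq hχ, h, one_mul]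
    simp only [paleyDigraph_four_adj_iff hχ, Finset.mem_filter, Finset.mem_univ, true_and,
      mem_squarePairs, sub_zero]
    constructor
    · rintro ⟨h1, h2, h3, h4, h5⟩
      exact ⟨⟨hη h1, hη h2, hη h3, hη h4, complexQuadraticChar_sub_comm hq d c ▸ hη h5⟩,
        h1, h2, h3, h4, h5⟩
    · rintro ⟨-, h⟩
      exact h
  rw [hcard, Finset.card_filter, Nat.cast_sum, Finset.mul_sum]
  refine Finset.sum_congr rfl fun ⟨c, d⟩ hx => ?_
  obtain ⟨h1, h2, h3, h4, h5⟩ := mem_squarePairs.mp hx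
  rw [complexQuadraticChar_sub_comm hq] at h5
  have hpm : ∀ {x : F}, complexQuadraticChar F x = 1 → χ x = 1 ∨ χ x = -1 := fun h =>
    mul_self_eq_one_iff.mp (MulChar.quartic_apply_mul_self_eq_one hχ h)
  dsimp only
  have hne : (-1 : ℂ) ≠ 1 := by norm_num
  rcases hpm h1 with h1 | h1 <;> rcases hpm h2 with h2 | h2 <;> rcases hpm h3 with h3 | h3 <;>
    rcases hpm h4 with h4 | h4 <;> rcases hpm h5 with h5 | h5 <;>
    rw [h1, h2, h3, h4, h5] <;> norm_num

end SquarePairs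

/-! ### Evaluation of the sums over `squarePairs` by Jacobi sums and twisted sums. -/

section CharacterSums

theorem sum_mulChar_mul_mulChar_sub {F : Type*} [Field F] [Fintype F] (ψ ρ : MulChar F ℂ) {d : F}
    (hd : d ≠ 0) :
    ∑ x, ψ x * ρ (d - x) = ψ d * ρ d * jacobiSum ψ ρ := by
  rw [jacobiSum, Finset.mul_sum, ← Equiv.sum_comp (Equiv.mulLeft₀ d hd)]
  refine Finset.sum_congr rfl fun x _ => ?_
  rw [show Equiv.mulLeft₀ d hd x = d * x from rfl, show d - d * x = d * (1 - x) by ring,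
    map_mul, map_mul]
  ring

variable {F : Type*} [Field F] [Fintype F] [DecidableEq F]

local notation "η" => complexQuadraticChar F

theorem sum_mulChar_mul_quadratic_sub_one (hq : Fintype.card F % 8 = 5) (ψ : MulChar F ℂ) :
    ∑ x, ψ x * η (x - 1) = jacobiSum ψ η :=
  Finset.sum_congr rfl fun x _ => by rw [complexQuadraticChar_sub_comm hq]

theorem sum_quadratic_sub (hq : Fintype.card F % 8 = 5) (a : F) : ∑ x, η (x - a) = 0 := by
  refine (Equiv.sum_comp (Equiv.subRight a) fun x => η x).trans ?_
  exact MulChar.sum_eq_zero_of_ne_one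
    (complexQuadraticChar_ne_one (ringChar_ne_two_of_card_mod_eight hq))

theorem sum_quadratic_sub' (hq : Fintype.card F % 8 = 5) (a : F) : ∑ x, η (a - x) = 0 := by
  rw [← sum_quadratic_sub hq a]
  exact Finset.sum_congr rfl fun x _ => complexQuadraticChar_sub_comm hq a x

theorem sum_quadratic (hq : Fintype.card F % 8 = 5) : ∑ x, η x = 0 := by
  simpa using sum_quadratic_sub hq (0 : F)

theorem sum_quadratic_sub_mul_quadratic_sub (hq : Fintype.card F % 8 = 5) {a b : F} (hab : a ≠ b) :
    ∑ x, η (x - a) * η (x - b) = -1 := by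
  have h := sum_mulChar_mul_mulChar_sub η η (sub_ne_zero.mpr hab.symm)
  rw [complexQuadraticChar_mul_self (sub_ne_zero.mpr hab.symm), one_mul] at h
  nth_rw 4 [← complexQuadraticChar_inv'] at h
  rw [jacobiSum_nontrivial_inv (complexQuadraticChar_ne_one
    (ringChar_ne_two_of_card_mod_eight hq)), complexQuadraticChar_neg_one hq,
    ← Equiv.sum_comp (Equiv.subRight a)] at h
  rw [← h]
  refine Finset.sum_congr rfl fun x _ => ?_
  rw [Equiv.subRight_apply, complexQuadraticChar_sub_comm hq (b - a)]
  congr 2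
  ring

theorem sum_quadratic_mul_quadratic_sub (hq : Fintype.card F % 8 = 5) {b : F} (hb : b ≠ 0) :
    ∑ x, η x * η (x - b) = -1 := by
  simpa using sum_quadratic_sub_mul_quadratic_sub hq hb.symm

/-- The sum of the quadratic character over the cubic `x (x - 1) (x - c)`. -/
noncomputable def legendreCubicSum (c : F) : ℂ := ∑ d, η d * η (d - 1) * η (d - c)

theorem legendreCubicSum_zero (hq : Fintype.card F % 8 = 5) : legendreCubicSum (0 : F) = -1 := by
  have h : ∀ d : F, η d * η (d - 1) * η (d - 0) = η (d - 1) - if d = 0 then 1 else 0 := by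
    intro d
    by_cases hd : d = 0
    · simp [hd, MulChar.map_zero, complexQuadraticChar_neg_one hq]
    · rw [if_neg hd, sub_zero]
      linear_combination η (d - 1) * complexQuadraticChar_mul_self hd
  rw [legendreCubicSum, Finset.sum_congr rfl fun d _ => h d, Finset.sum_sub_distrib,
    sum_quadratic_sub hq]
  simp

theorem legendreCubicSum_one (hq : Fintype.card F % 8 = 5) : legendreCubicSum (1 : F) = -1 := by
  have h : ∀ d : F, η d * η (d - 1) * η (d - 1) = η d - if d = 1 then 1 else 0 := by
    intro d
    by_cases hd : d = 1
    · simp [hd, MulChar.map_zero]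
    · rw [if_neg hd]
      linear_combination η d * complexQuadraticChar_mul_self (sub_ne_zero.mpr hd)
  rw [legendreCubicSum, Finset.sum_congr rfl fun d _ => h d, Finset.sum_sub_distrib,
    sum_quadratic hq]
  simp

theorem two_mul_ite_quadratic_eq_one [∀ z : ℂ, Decidable (z = 1)] (x : F) :
    2 * (if η x = 1 then (1 : ℂ) else 0) = 1 + η x - if x = 0 then 1 else 0 := by
  by_cases hx : x = 0
  · simp [hx, MulChar.map_zero]
  · rcases complexQuadraticChar_eq_one_or_neg_one hx with h | h
    · rw [h]; simp [hx]; norm_num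
    · have : (-1 : ℂ) ≠ 1 := by norm_num
      rw [h]; simp [hx, this]

theorem sum_compl_zero_one (f : F → ℂ) :
    ∑ c ∈ ({0, 1}ᶜ : Finset F), f c = ∑ c, f c - f 0 - f 1 := by
  rw [← Finset.sum_add_sum_compl ({0, 1} : Finset F) f, Finset.sum_pair zero_ne_one]
  ring

theorem ne_of_mem_compl_zero_one {c : F} (hc : c ∈ ({0, 1}ᶜ : Finset F)) : c ≠ 0 ∧ c ≠ 1 := by
  simpa using hc

theorem sum_squarePairs_fiber [∀ z : ℂ, Decidable (z = 1)] (hq : Fintype.card F % 8 = 5) {c : F}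
    (h0 : c ≠ 0) (h1 : c ≠ 1) :
    8 * ∑ d, ((if η d = 1 then (1 : ℂ) else 0) * (if η (d - 1) = 1 then (1 : ℂ) else 0) *
        (if η (c - d) = 1 then (1 : ℂ) else 0)) =
      Fintype.card F - 8 - 3 * η c - 3 * η (c - 1) - η c * η (c - 1) + legendreCubicSum c := by
  -- At d = 0, 1, c one factor 1 + η equals 1 where the doubled indicator is 0; the three subtracted
  -- terms correct this.
  have hpt : ∀ d : F, 8 * ((if η d = 1 then (1 : ℂ) else 0) *
      (if η (d - 1) = 1 then (1 : ℂ) else 0) * (if η (c - d) = 1 then (1 : ℂ) else 0)) =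
      1 + η d + η (d - 1) + η (d - c) + η d * η (d - 1) + η d * η (d - c) +
      η (d - 1) * η (d - c) + η d * η (d - 1) * η (d - c) -
      (if d = 0 then 2 * (1 + η c) else 0) - (if d = 1 then 2 * (1 + η (c - 1)) else 0) -
      (if d = c then (1 + η c) * (1 + η (c - 1)) else 0) := by
    intro d
    rw [complexQuadraticChar_sub_comm hq c d]
    have e0 := two_mul_ite_quadratic_eq_one d
    have e1 := two_mul_ite_quadratic_eq_one (d - 1)
    have e2 := two_mul_ite_quadratic_eq_one (d - c)
    rw [show ∀ x y z : ℂ, 8 * (x * y * z) = (2 * x) * (2 * y) * (2 * z) by intros; ring,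
      e0, e1, e2]
    simp only [sub_eq_zero]
    by_cases hd0 : d = 0
    · subst hd0
      rw [complexQuadraticChar_sub_comm hq 0 c, sub_zero]
      simp [h0.symm, MulChar.map_zero, complexQuadraticChar_neg_one hq]
      ring
    by_cases hd1 : d = 1
    · subst hd1
      rw [complexQuadraticChar_sub_comm hq 1 c]
      simp [h1.symm, MulChar.map_zero]
      ring
    by_cases hdc : d = c
    · subst hdc
      simp [hd0, hd1, MulChar.map_zero]
      ring
    simp [hd0, hd1, hdc]
    ring
  rw [Finset.mul_sum, Finset.sum_congr rfl fun d _ => hpt d]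
  simp only [Finset.sum_sub_distrib, Finset.sum_add_distrib]
  rw [sum_quadratic hq, sum_quadratic_sub hq, sum_quadratic_sub hq,
    sum_quadratic_mul_quadratic_sub hq one_ne_zero, sum_quadratic_mul_quadratic_sub hq h0,
    sum_quadratic_sub_mul_quadratic_sub hq h1.symm, legendreCubicSum]
  simp only [Finset.sum_const, Finset.card_univ, nsmul_eq_mul, Finset.sum_ite_eq', Finset.mem_univ,
    if_true]
  ring

theorem sum_squarePairs_fst (hq : Fintype.card F % 8 = 5) (g : F → ℂ) :
    32 * ∑ x ∈ squarePairs F, g x.1 = ∑ c ∈ ({0, 1}ᶜ : Finset F),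
      g c * (1 + η c) * (1 + η (c - 1)) * (Fintype.card F - 15 + legendreCubicSum c) := by
  classical
  have h : ∑ x ∈ squarePairs F, g x.1 = ∑ c, g c * (if η c = 1 then (1 : ℂ) else 0) *
      (if η (c - 1) = 1 then (1 : ℂ) else 0) * ∑ d, ((if η d = 1 then (1 : ℂ) else 0) *
      (if η (d - 1) = 1 then (1 : ℂ) else 0) * (if η (c - d) = 1 then (1 : ℂ) else 0)) := by
    rw [squarePairs, Finset.sum_filter, Fintype.sum_prod_type]
    refine Finset.sum_congr rfl fun c _ => ?_
    rw [Finset.mul_sum]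
    refine Finset.sum_congr rfl fun d _ => ?_
    dsimp only
    by_cases h1 : η c = 1 <;> by_cases h2 : η d = 1 <;> by_cases h3 : η (c - 1) = 1 <;>
      by_cases h4 : η (d - 1) = 1 <;> by_cases h5 : η (c - d) = 1 <;> simp [h1, h2, h3, h4, h5]
  rw [h, ← Finset.sum_add_sum_compl ({0, 1} : Finset F), Finset.sum_pair zero_ne_one]
  simp only [MulChar.map_zero, sub_self, zero_ne_one, if_false, mul_zero, zero_mul, zero_add]
  rw [Finset.mul_sum]
  refine Finset.sum_congr rfl fun c hc => ?_
  obtain ⟨h0, h1⟩ := ne_of_mem_compl_zero_one hc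
  have e0 := two_mul_ite_quadratic_eq_one c
  have e1 := two_mul_ite_quadratic_eq_one (c - 1)
  rw [if_neg h0] at e0
  rw [if_neg (sub_ne_zero.mpr h1)] at e1
  rw [show ∀ u x y z : ℂ, 32 * (u * x * y * z) = u * (2 * x) * (2 * y) * (8 * z) by intros; ring,
    e0, e1, sum_squarePairs_fiber hq h0 h1]
  have s0 := complexQuadraticChar_mul_self h0
  have s1 := complexQuadraticChar_mul_self (sub_ne_zero.mpr h1)
  -- Against the factor 1 + η(c), η(c) acts as 1, and likewise for c - 1; so the constant becomes -8
  -- - 3 - 3 - 1 = -15.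
  linear_combination g c * (1 + η (c - 1)) * (-3 - η (c - 1)) * s0 +
    g c * (1 + η c) * (-4) * s1

/-- The sum of `ψ(c) η(c - 1) η(d) η(d - 1) η(d - c)` over all `c` and `d`. -/
noncomputable def twistedLegendreSum (ψ : MulChar F ℂ) : ℂ :=
  ∑ c, ψ c * η (c - 1) * legendreCubicSum c

/-- Summing over c first gives ψ(d)η(d)J(ψ,η). The two factors η(d) cancel, and the remaining sum
over d is J(ψ,η) again. -/
theorem sum_mulChar_mul_legendreCubicSum (hq : Fintype.card F % 8 = 5) (ψ : MulChar F ℂ) :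
    ∑ c, ψ c * legendreCubicSum c = jacobiSum ψ η ^ 2 := by
  simp only [legendreCubicSum, Finset.mul_sum]
  rw [Finset.sum_comm, sq]
  conv_rhs => rw [← sum_mulChar_mul_quadratic_sub_one hq, Finset.sum_mul]
  refine Finset.sum_congr rfl fun d _ => ?_
  by_cases hd : d = 0
  · simp [hd, MulChar.map_zero]
  · have h := sum_mulChar_mul_mulChar_sub ψ η hd
    calc ∑ c, ψ c * (η d * η (d - 1) * η (d - c))
        = η d * η (d - 1) * ∑ c, ψ c * η (d - c) := by
          rw [Finset.mul_sum]
          exact Finset.sum_congr rfl fun c _ => by ring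
      _ = ψ d * η (d - 1) * ∑ x, ψ x * η (x - 1) := by
          rw [h, sum_mulChar_mul_quadratic_sub_one hq]
          linear_combination ψ d * η (d - 1) * jacobiSum ψ η * complexQuadraticChar_mul_self hd

theorem sum_mulChar_mul_one_add_quadratic (hq : Fintype.card F % 8 = 5) {ψ : MulChar F ℂ}
    (hψ : ψ ≠ 1) :
    ∑ c ∈ ({0, 1}ᶜ : Finset F),
      ψ c * (1 + η (c - 1)) * (Fintype.card F - 15 + legendreCubicSum c) =
      (Fintype.card F - 15) * (jacobiSum ψ η - 1) + 1 + jacobiSum ψ η ^ 2 +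
        twistedLegendreSum ψ := by
  have h : ∑ c : F, ψ c * (1 + η (c - 1)) * (Fintype.card F - 15 + legendreCubicSum c) =
      (Fintype.card F - 15) * jacobiSum ψ η + jacobiSum ψ η ^ 2 + twistedLegendreSum ψ := by
    calc _ = ∑ c : F, ((Fintype.card F - 15) * ψ c +
          (Fintype.card F - 15) * (ψ c * η (c - 1)) + ψ c * legendreCubicSum c +
          ψ c * η (c - 1) * legendreCubicSum c) := Finset.sum_congr rfl fun c _ => by ring
      _ = _ := by
        simp only [Finset.sum_add_distrib, ← Finset.mul_sum]
        rw [MulChar.sum_eq_zero_of_ne_one hψ, sum_mulChar_mul_quadratic_sub_one hq,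
          sum_mulChar_mul_legendreCubicSum hq, twistedLegendreSum]
        ring
  rw [sum_compl_zero_one, h, MulChar.map_zero, sub_self, MulChar.map_zero, MulChar.map_one,
    legendreCubicSum_one hq]
  ring

theorem MulChar.quartic_mul_quadratic {χ : MulChar F ℂ} (hχ : χ ^ 2 = η) : χ * η = χ⁻¹ := by
  have h4 : χ ^ 4 = 1 := by
    rw [show χ ^ 4 = (χ ^ 2) * (χ ^ 2) by group, hχ]
    nth_rw 1 [← complexQuadraticChar_inv']
    exact inv_mul_cancel _
  rw [eq_inv_iff_mul_eq_one, ← hχ, ← h4]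
  group

theorem MulChar.quartic_ne_one (hq : Fintype.card F % 8 = 5) {χ : MulChar F ℂ} (hχ : χ ^ 2 = η) :
    χ ≠ 1 := by
  rintro rfl
  rw [one_pow] at hχ
  exact complexQuadraticChar_ne_one (ringChar_ne_two_of_card_mod_eight hq) hχ.symm

/-- Since χη = χ⁻¹, the factor χ(c)(1 + η(c)) splits into χ(c) + χ⁻¹(c). -/
theorem sum_squarePairs_quartic (hq : Fintype.card F % 8 = 5) {χ : MulChar F ℂ} (hχ : χ ^ 2 = η) :
    32 * ∑ x ∈ squarePairs F, χ x.1 =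
      (Fintype.card F - 15) * (jacobiSum χ η - 1) + 1 + jacobiSum χ η ^ 2 +
        twistedLegendreSum χ + ((Fintype.card F - 15) * (jacobiSum χ⁻¹ η - 1) + 1 +
        jacobiSum χ⁻¹ η ^ 2 + twistedLegendreSum χ⁻¹) := by
  have h1 := MulChar.quartic_ne_one hq hχ
  rw [sum_squarePairs_fst hq, ← sum_mulChar_mul_one_add_quadratic hq h1,
    ← sum_mulChar_mul_one_add_quadratic hq (inv_ne_one.mpr h1), ← Finset.sum_add_distrib]
  refine Finset.sum_congr rfl fun c _ => ?_
  rw [← MulChar.quartic_mul_quadratic hχ, MulChar.mul_apply]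
  ring

theorem sum_legendreCubicSum (hq : Fintype.card F % 8 = 5) :
    ∑ c : F, legendreCubicSum c = 0 := by
  simp only [legendreCubicSum]
  rw [Finset.sum_comm]
  refine Finset.sum_eq_zero fun d _ => ?_
  rw [← Finset.mul_sum, sum_quadratic_sub' hq, mul_zero]

theorem sum_quadratic_mul_legendreCubicSum (hq : Fintype.card F % 8 = 5) :
    ∑ c : F, η c * legendreCubicSum c = 1 := by
  have h : jacobiSum η η = -1 := by
    rw [← sum_mulChar_mul_quadratic_sub_one hq, sum_quadratic_mul_quadratic_sub hq one_ne_zero]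
  rw [sum_mulChar_mul_legendreCubicSum hq, h]
  norm_num

/-- The cubic sum is invariant under `c ↦ 1 - c`, which turns η(c-1) into η(c). -/
theorem sum_quadratic_sub_one_mul_legendreCubicSum (hq : Fintype.card F % 8 = 5) :
    ∑ c : F, η (c - 1) * legendreCubicSum c = 1 := by
  rw [← sum_quadratic_mul_legendreCubicSum hq, ← Equiv.sum_comp (Equiv.subLeft (1 : F))]
  refine Finset.sum_congr rfl fun c _ => ?_
  rw [Equiv.subLeft_apply, sub_sub_cancel_left, ← neg_one_mul c, map_mul,
    complexQuadraticChar_neg_one hq, one_mul, legendreCubicSum, legendreCubicSum,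
    ← Equiv.sum_comp (Equiv.subLeft (1 : F))]
  congr 1
  refine Finset.sum_congr rfl fun d _ => ?_
  rw [Equiv.subLeft_apply, sub_sub_cancel_left, ← neg_one_mul d, map_mul,
    complexQuadraticChar_neg_one hq, one_mul, complexQuadraticChar_sub_comm hq 1 d,
    show 1 - d - (1 - c) = c - d by ring, complexQuadraticChar_sub_comm hq c d]
  ring

theorem card_squarePairs (hq : Fintype.card F % 8 = 5) :
    32 * ((squarePairs F).card : ℂ) =
      (Fintype.card F - 15) * (Fintype.card F - 5) + 6 + twistedLegendreSum η := by
  have hX : ((squarePairs F).card : ℂ) = ∑ x ∈ squarePairs F, (1 : ℂ) := by simp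
  rw [hX, sum_squarePairs_fst hq fun _ => 1, sum_compl_zero_one]
  have h : ∑ c : F, 1 * (1 + η c) * (1 + η (c - 1)) *
      (Fintype.card F - 15 + legendreCubicSum c) =
      (Fintype.card F - 15) * (Fintype.card F - 1) + 2 + twistedLegendreSum η := by
    calc _ = ∑ c : F, ((Fintype.card F - 15) * 1 + (Fintype.card F - 15) * η c +
          (Fintype.card F - 15) * η (c - 1) + (Fintype.card F - 15) * (η c * η (c - 1)) +
          legendreCubicSum c + η c * legendreCubicSum c + η (c - 1) * legendreCubicSum c +
          η c * η (c - 1) * legendreCubicSum c) := Finset.sum_congr rfl fun c _ => by ring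
      _ = _ := by
        simp only [Finset.sum_add_distrib, ← Finset.mul_sum]
        rw [sum_quadratic hq, sum_quadratic_sub hq,
          sum_quadratic_mul_quadratic_sub hq one_ne_zero, sum_legendreCubicSum hq,
          sum_quadratic_mul_legendreCubicSum hq, sum_quadratic_sub_one_mul_legendreCubicSum hq,
          twistedLegendreSum]
        simp only [Finset.sum_const, Finset.card_univ, nsmul_eq_mul]
        ring
  -- The removed terms at c = 0 and c = 1 are each 2(q - 15 - 1).
  rw [h, legendreCubicSum_zero hq, legendreCubicSum_one hq, MulChar.map_zero, zero_sub,
    complexQuadraticChar_neg_one hq, MulChar.map_one, sub_self, MulChar.map_zero]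
  ring

/-- Inverting c and d introduces only even powers of η(c) and η(d). Hence χ and χ⁻¹ contribute the
same hypergeometric value. -/
theorem twistedLegendreSum_inv (hq : Fintype.card F % 8 = 5) (ψ : MulChar F ℂ) :
    twistedLegendreSum ψ⁻¹ = twistedLegendreSum ψ := by
  simp only [twistedLegendreSum, legendreCubicSum, Finset.mul_sum]
  have hinv : Function.Involutive (fun x : F => x⁻¹) := inv_inv
  rw [← Equiv.sum_comp hinv.toPerm]
  refine Finset.sum_congr rfl fun c _ => ?_
  rw [← Equiv.sum_comp hinv.toPerm]
  refine Finset.sum_congr rfl fun d _ => ?_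
  simp only [Function.Involutive.coe_toPerm, MulChar.inv_apply', inv_inv]
  by_cases hc : c = 0
  · simp [hc, MulChar.map_zero]
  by_cases hd : d = 0
  · simp [hd, MulChar.map_zero]
  rw [show c⁻¹ - 1 = (1 - c) * c⁻¹ by field_simp, show d⁻¹ - 1 = (1 - d) * d⁻¹ by field_simp,
    show d⁻¹ - c⁻¹ = (c - d) * c⁻¹ * d⁻¹ by field_simp]
  simp only [map_mul, complexQuadraticChar_inv]
  rw [complexQuadraticChar_sub_comm hq 1 c, complexQuadraticChar_sub_comm hq 1 d,
    complexQuadraticChar_sub_comm hq c d]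
  have s0 := complexQuadraticChar_mul_self hc
  have s1 := complexQuadraticChar_mul_self hd
  linear_combination ψ c * η (c - 1) * η (d - 1) * η (d - c) * η d ^ 3 * s0 +
    ψ c * η (c - 1) * η (d - 1) * η (d - c) * η d * s1

end CharacterSums

/-! ### Evaluation of the twisted sum at η by Jacobi sums. -/

section QuarticEvaluation

theorem sum_comp_eq_sum_card_mul {α F : Type*} [Fintype F] [DecidableEq F]
    (s : Finset α) (g : α → F) (f : F → ℂ) :
    ∑ z ∈ s, f (g z) = ∑ c, ((s.filter fun z => g z = c).card : ℂ) * f c := by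
  rw [← Finset.sum_fiberwise s g]
  refine Finset.sum_congr rfl fun c _ => ?_
  rw [Finset.sum_congr rfl (g := fun _ => f c) fun z hz => by rw [(Finset.mem_filter.mp hz).2],
    Finset.sum_const, nsmul_eq_mul]

theorem four_ne_zero_of_ringChar_ne_two {F : Type*} [Field F]
    (hF : ringChar F ≠ 2) : (4 : F) ≠ 0 := by
  have := Ring.two_ne_zero hF
  rw [show (4 : F) = 2 * 2 by norm_num]
  exact mul_ne_zero this this

variable {F : Type*} [Field F] [Fintype F] [DecidableEq F]

local notation "η" => complexQuadraticChar F

theorem card_sq_eq_add_one (hF : ringChar F ≠ 2) (a : F) :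
    ((Finset.univ.filter fun x : F => x ^ 2 = a).card : ℂ) = 1 + η a := by
  have h := quadraticChar_card_sqrts hF a
  rw [Set.toFinset_ofPred] at h
  rw [complexQuadraticChar_apply, add_comm, ← Int.cast_one, ← Int.cast_add, ← h, Int.cast_natCast]

theorem sum_sq_eq_sum_one_add_quadratic (hF : ringChar F ≠ 2) (f : F → ℂ) :
    ∑ w, f (w ^ 2) = ∑ v, (1 + η v) * f v := by
  rw [sum_comp_eq_sum_card_mul]
  exact Finset.sum_congr rfl fun v _ => by rw [card_sq_eq_add_one hF]

theorem complexQuadraticChar_four (hF : ringChar F ≠ 2) : η 4 = 1 := by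
  rw [show (4 : F) = 2 * 2 by norm_num, map_mul,
    complexQuadraticChar_mul_self (Ring.two_ne_zero hF)]

/-- The substitution `c = (z + 1)² / (4 z)` rationalizes the square root of `c (c - 1)`. -/
theorem sum_rationalize (hF : ringChar F ≠ 2) (f : F → ℂ) :
    ∑ z ∈ ({0}ᶜ : Finset F), f ((z + 1) ^ 2 * (4 * z)⁻¹) = ∑ c, (1 + η (c * (c - 1))) * f c := by
  have h4 := four_ne_zero_of_ringChar_ne_two hF
  rw [sum_comp_eq_sum_card_mul]
  refine Finset.sum_congr rfl fun c _ => ?_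
  congr 1
  rw [show η (c * (c - 1)) = η (4 * (c * (c - 1))) by
    rw [map_mul _ 4, complexQuadraticChar_four hF, one_mul], ← card_sq_eq_add_one hF]
  congr 1
  -- Completing the square in (z+1)² = 4cz gives (z - (2c-1))² = 4c(c-1).
  refine Finset.card_nbij' (fun z => z - (2 * c - 1)) (fun y => y + (2 * c - 1)) ?_ ?_ ?_ ?_
  · intro z hz
    simp only [Finset.mem_filter, Finset.mem_compl, Finset.mem_singleton, Finset.mem_univ,
      true_and, Finset.mem_coe] at hz ⊢
    obtain ⟨hz0, hz⟩ := hz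
    rw [← hz]
    field_simp
    ring
  · intro y hy
    simp only [Finset.mem_filter, Finset.mem_compl, Finset.mem_singleton, Finset.mem_univ,
      true_and, Finset.mem_coe] at hy ⊢
    -- z = 0 would give (1 - 2c)² = 4c(c-1), whose sides differ by 1.
    have hz0 : y + (2 * c - 1) ≠ 0 := by
      intro h
      have hy' : y = 1 - 2 * c := by linear_combination h
      rw [hy'] at hy
      exact one_ne_zero (by linear_combination hy : (1 : F) = 0)
    refine ⟨hz0, ?_⟩
    rw [← div_eq_mul_inv, div_eq_iff (mul_ne_zero h4 hz0)]
    linear_combination hy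
  · intro z _
    ring
  · intro y _
    ring

/-- η(w) = χ(w²), v has 1 + η(v) square roots, and χ(1 + η) = χ + χ⁻¹. -/
theorem sum_quadratic_mul_comp_sq (hF : ringChar F ≠ 2) {χ : MulChar F ℂ} (hχ : χ ^ 2 = η)
    (f : F → ℂ) : ∑ w, η w * f (w ^ 2) = ∑ v, (χ v + χ⁻¹ v) * f v := by
  have h : ∀ w : F, η w * f (w ^ 2) = χ (w ^ 2) * f (w ^ 2) := fun w => by
    rw [sq, map_mul, MulChar.apply_mul_self_of_sq_eq hχ]
  rw [Finset.sum_congr rfl fun w _ => h w,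
    sum_sq_eq_sum_one_add_quadratic hF fun v => χ v * f v]
  refine Finset.sum_congr rfl fun v _ => ?_
  rw [← MulChar.quartic_mul_quadratic hχ, MulChar.mul_apply]
  ring

/-- This writes twice the real part of J(χ,η) as an integral sum of η-values, which can be reduced
modulo p. -/
theorem sum_quadratic_mul_quadratic_sq_sub_one (hq : Fintype.card F % 8 = 5) {χ : MulChar F ℂ}
    (hχ : χ ^ 2 = η) :
    ∑ w, η w * η (w ^ 2 - 1) = jacobiSum χ η + jacobiSum χ⁻¹ η := by
  rw [sum_quadratic_mul_comp_sq (ringChar_ne_two_of_card_mod_eight hq) hχ fun v => η (v - 1),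
    ← sum_mulChar_mul_quadratic_sub_one hq, ← sum_mulChar_mul_quadratic_sub_one hq,
    ← Finset.sum_add_distrib]
  exact Finset.sum_congr rfl fun v _ => add_mul _ _ _

theorem sum_mulChar_mul_quadratic_mul_sub_one (hq : Fintype.card F % 8 = 5) (ψ : MulChar F ℂ)
    {b : F} (hb : b ≠ 0) : ∑ v, ψ v * η (v * b - 1) = ψ⁻¹ b * jacobiSum ψ η := by
  rw [← sum_mulChar_mul_quadratic_sub_one hq, Finset.mul_sum,
    ← Equiv.sum_comp (Equiv.mulRight₀ b hb) fun x => ψ⁻¹ b * (ψ x * η (x - 1))]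
  refine Finset.sum_congr rfl fun v _ => ?_
  have h : ψ⁻¹ b * ψ b = 1 := by
    rw [← MulChar.mul_apply, inv_mul_cancel, MulChar.one_apply hb.isUnit]
  rw [show Equiv.mulRight₀ b hb v = v * b from rfl, map_mul]
  linear_combination -ψ v * η (v * b - 1) * h

theorem sum_quadratic_mul_mulChar_inv (hq : Fintype.card F % 8 = 5) {χ : MulChar F ℂ}
    (hχ : χ ^ 2 = η) :
    ∑ b, η b * η (b - 1) * ∑ v, χ v * η (v * b - 1) = jacobiSum χ η ^ 2 := by
  have h : ∀ b, η b * η (b - 1) * ∑ v, χ v * η (v * b - 1) =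
      jacobiSum χ η * (χ b * η (b - 1)) := by
    intro b
    by_cases hb : b = 0
    · simp [hb, MulChar.map_zero]
    · have hηχ : χ b = η b * χ⁻¹ b := by
        rw [← MulChar.mul_apply, ← hχ, sq, mul_inv_cancel_right]
      rw [sum_mulChar_mul_quadratic_mul_sub_one hq χ hb, hηχ]
      ring
  rw [Finset.sum_congr rfl fun b _ => h b, ← Finset.mul_sum,
    sum_mulChar_mul_quadratic_sub_one hq, sq]

theorem sum_quadratic_rationalize (hq : Fintype.card F % 8 = 5) (f : F → ℂ) (hf : ∑ c, f c = 0) :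
    ∑ c, η (c * (c - 1)) * f c = ∑ z ∈ ({0}ᶜ : Finset F), f ((z + 1) ^ 2 * (4 * z)⁻¹) := by
  rw [sum_rationalize (ringChar_ne_two_of_card_mod_eight hq), ← sub_eq_zero,
    ← Finset.sum_sub_distrib, ← neg_eq_zero, ← Finset.sum_neg_distrib, ← hf]
  exact Finset.sum_congr rfl fun c _ => by ring

/-- Rationalising both c and d makes c - d equal to (z-w)(zw-1)/(4zw). -/
theorem twistedLegendreSum_quadratic_eq_sum (hq : Fintype.card F % 8 = 5) :
    twistedLegendreSum η = ∑ w ∈ ({0}ᶜ : Finset F), ∑ z ∈ ({0}ᶜ : Finset F),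
      η (z * w * (z - w) * (z * w - 1)) := by
  have hF := ringChar_ne_two_of_card_mod_eight hq
  have h4 := four_ne_zero_of_ringChar_ne_two hF
  have h1 : twistedLegendreSum η =
      ∑ c, η (c * (c - 1)) * ∑ d, η (d * (d - 1)) * η (c - d) := by
    rw [twistedLegendreSum]
    refine Finset.sum_congr rfl fun c _ => ?_
    rw [legendreCubicSum, Finset.mul_sum, Finset.mul_sum]
    refine Finset.sum_congr rfl fun d _ => ?_
    rw [map_mul, map_mul, complexQuadraticChar_sub_comm hq c d]
  have h2 : ∀ c, ∑ d, η (d * (d - 1)) * η (c - d) =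
      ∑ w ∈ ({0}ᶜ : Finset F), η (c - (w + 1) ^ 2 * (4 * w)⁻¹) := fun c =>
    sum_quadratic_rationalize hq (fun d => η (c - d)) (sum_quadratic_sub' hq c)
  rw [h1, Finset.sum_congr rfl fun c _ => by rw [h2 c], sum_quadratic_rationalize hq
    (fun c => ∑ w ∈ ({0}ᶜ : Finset F), η (c - (w + 1) ^ 2 * (4 * w)⁻¹)), Finset.sum_comm]
  · refine Finset.sum_congr rfl fun w hw => Finset.sum_congr rfl fun z hz => ?_
    have hw0 : w ≠ 0 := by simpa using hw
    have hz0 : z ≠ 0 := by simpa using hz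
    have h : (z + 1) ^ 2 * (4 * z)⁻¹ - (w + 1) ^ 2 * (4 * w)⁻¹ =
        (4 : F)⁻¹ * z⁻¹ * w⁻¹ * (z - w) * (z * w - 1) := by
      field_simp
      ring
    rw [h]
    simp only [map_mul]
    rw [complexQuadraticChar_inv, complexQuadraticChar_inv, complexQuadraticChar_inv,
      complexQuadraticChar_four hF, one_mul]
  · rw [Finset.sum_comm]
    exact Finset.sum_eq_zero fun w _ => sum_quadratic_sub hq _

/-- Putting z = wb leaves w only in η(w)η(w²b-1). The sum over w then splits into a χ-part and a
χ⁻¹-part, and each gives the square of a Jacobi sum. -/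
theorem twistedLegendreSum_quadratic (hq : Fintype.card F % 8 = 5) {χ : MulChar F ℂ}
    (hχ : χ ^ 2 = η) :
    twistedLegendreSum η = jacobiSum χ η ^ 2 + jacobiSum χ⁻¹ η ^ 2 := by
  have hχ' : χ⁻¹ ^ 2 = η := by rw [inv_pow, hχ, complexQuadraticChar_inv']
  have h : ∀ w ∈ ({0}ᶜ : Finset F), ∑ z ∈ ({0}ᶜ : Finset F), η (z * w * (z - w) * (z * w - 1)) =
      ∑ b, η b * η (b - 1) * (η w * η (w ^ 2 * b - 1)) := by
    intro w hw
    have hw0 : w ≠ 0 := by simpa using hw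
    have hz : ∑ z ∈ ({0}ᶜ : Finset F), η (z * w * (z - w) * (z * w - 1)) =
        ∑ z, η (z * w * (z - w) * (z * w - 1)) := by
      rw [← Finset.sum_add_sum_compl ({0} : Finset F), Finset.sum_singleton, zero_mul, zero_mul,
        zero_mul, MulChar.map_zero, zero_add]
    rw [hz, ← Equiv.sum_comp (Equiv.mulLeft₀ w hw0)]
    refine Finset.sum_congr rfl fun b _ => ?_
    rw [show Equiv.mulLeft₀ w hw0 b = w * b from rfl,
      show w * b * w * (w * b - w) * (w * b * w - 1) =
        w * w * w * b * (b - 1) * (w ^ 2 * b - 1) by ring]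
    simp only [map_mul]
    linear_combination η w * η b * η (b - 1) * η (w ^ 2 * b - 1) *
      complexQuadraticChar_mul_self hw0
  rw [twistedLegendreSum_quadratic_eq_sum hq, Finset.sum_congr rfl h]
  have hw : ∑ w ∈ ({0}ᶜ : Finset F), ∑ b, η b * η (b - 1) * (η w * η (w ^ 2 * b - 1)) =
      ∑ w, ∑ b, η b * η (b - 1) * (η w * η (w ^ 2 * b - 1)) := by
    rw [← Finset.sum_add_sum_compl ({0} : Finset F), Finset.sum_singleton]
    simp [MulChar.map_zero]
  rw [hw, Finset.sum_comm, ← sum_quadratic_mul_mulChar_inv hq hχ,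
    ← sum_quadratic_mul_mulChar_inv hq hχ', ← Finset.sum_add_distrib]
  refine Finset.sum_congr rfl fun b _ => ?_
  rw [← Finset.mul_sum, sum_quadratic_mul_comp_sq (ringChar_ne_two_of_card_mod_eight hq) hχ
    fun v => η (v * b - 1), ← mul_add, ← Finset.sum_add_distrib]
  congr 1
  exact Finset.sum_congr rfl fun v _ => add_mul _ _ _

end QuarticEvaluation

/-! ### The hypergeometric value as a twisted Legendre sum. -/

section Hypergeometric

theorem jacobiSum_mul_inv_eq_sum {F : Type*} [Field F] [Fintype F] (A ψ : MulChar F ℂ) :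
    jacobiSum (A * ψ) ψ⁻¹ = ∑ a, A a * ψ (a * (1 - a)⁻¹) := by
  refine Finset.sum_congr rfl fun a _ => ?_
  rw [MulChar.mul_apply, MulChar.inv_apply', map_mul, mul_assoc]

variable {F : Type*} [Field F] [Fintype F] [DecidableEq F]

local notation "η" => complexQuadraticChar F

theorem sum_mulChar_apply [Fintype (MulChar F ℂ)] (a : F) :
    ∑ ψ : MulChar F ℂ, ψ a = if a = 1 then (Fintype.card F : ℂ) - 1 else 0 := by
  split_ifs with ha
  · subst ha
    have h := MulChar.card_eq_card_units_of_hasEnoughRootsOfUnity F ℂ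
    rw [Nat.card_eq_fintype_card, Nat.card_eq_fintype_card, Fintype.card_units] at h
    simp only [MulChar.map_one, Finset.sum_const, Finset.card_univ, nsmul_eq_mul, mul_one]
    rw [h, Nat.cast_sub Fintype.card_pos, Nat.cast_one]
  · obtain ⟨χ, hχ⟩ := MulChar.exists_apply_ne_one_of_hasEnoughRootsOfUnity F ℂ ha
    refine eq_zero_of_mul_eq_self_left hχ ?_
    rw [Finset.mul_sum, ← Equiv.sum_comp (Equiv.mulLeft χ) fun ψ => ψ a]
    exact Finset.sum_congr rfl fun ψ _ => (MulChar.mul_apply χ ψ a).symm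

theorem sum_quadratic_mul_ite (hq : Fintype.card F % 8 = 5) {a c : F} (ha : a ≠ 0) (hc : c ≠ 0) :
    ∑ b, η b * (if -1 * (a * (1 - a)⁻¹) * (c * (1 - c)⁻¹) * (b * (1 - b)⁻¹) = 1 then (1 : ℂ)
      else 0) = η (a - 1) * η (1 - c) * η (1 - c - a) := by
  by_cases ha1 : a = 1
  · simp [ha1, MulChar.map_zero]
  by_cases hc1 : c = 1
  · simp [hc1, MulChar.map_zero]
  have ha1' : 1 - a ≠ 0 := sub_ne_zero.mpr (Ne.symm ha1)
  have hc1' : 1 - c ≠ 0 := sub_ne_zero.mpr (Ne.symm hc1)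
  have hcond : ∀ b : F, -1 * (a * (1 - a)⁻¹) * (c * (1 - c)⁻¹) * (b * (1 - b)⁻¹) = 1 ↔
      b * (1 - c - a) = (1 - a) * (1 - c) := by
    intro b
    -- With `0⁻¹ = 0` the left condition reads 0 = 1 at b = 1; the right one would force ac = 0.
    by_cases hb : b = 1
    · subst hb
      simp only [sub_self, inv_zero, mul_zero, zero_ne_one, one_mul, false_iff]
      intro h
      exact mul_ne_zero ha hc (by linear_combination -h)
    · have hb' : 1 - b ≠ 0 := sub_ne_zero.mpr (Ne.symm hb)
      have e : -1 * (a * (1 - a)⁻¹) * (c * (1 - c)⁻¹) * (b * (1 - b)⁻¹) =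
          -(a * c * b) / ((1 - a) * (1 - c) * (1 - b)) := by
        field_simp
      rw [e, div_eq_iff (mul_ne_zero (mul_ne_zero ha1' hc1') hb'), one_mul]
      constructor <;> intro h <;> linear_combination h
  simp only [hcond]
  by_cases hac : 1 - c - a = 0
  · rw [hac, MulChar.map_zero, mul_zero]
    refine Finset.sum_eq_zero fun b _ => ?_
    rw [mul_zero, if_neg (mul_ne_zero ha1' hc1').symm, mul_zero]
  · have hcond' : ∀ b : F, b * (1 - c - a) = (1 - a) * (1 - c) ↔
        b = (1 - a) * (1 - c) * (1 - c - a)⁻¹ := fun b => by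
      rw [← div_eq_mul_inv, eq_div_iff hac]
    simp only [hcond', mul_ite, mul_one, mul_zero, Finset.sum_ite_eq', Finset.mem_univ, if_true]
    rw [map_mul, map_mul, complexQuadraticChar_inv, complexQuadraticChar_sub_comm hq 1 a]

theorem twistedLegendreSum_eq_sum_ite (hq : Fintype.card F % 8 = 5) (χ : MulChar F ℂ) :
    twistedLegendreSum χ = ∑ a, ∑ c, ∑ b, χ a * η c * η b *
      (if -1 * (a * (1 - a)⁻¹) * (c * (1 - c)⁻¹) * (b * (1 - b)⁻¹) = 1 then (1 : ℂ)
      else 0) := by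
  simp only [twistedLegendreSum, legendreCubicSum]
  refine Finset.sum_congr rfl fun a _ => ?_
  rw [← Equiv.sum_comp (Equiv.subLeft (1 : F)), Finset.mul_sum]
  refine Finset.sum_congr rfl fun c _ => ?_
  rw [Equiv.subLeft_apply]
  by_cases ha : a = 0
  · simp [ha, MulChar.map_zero]
  by_cases hc : c = 0
  · simp [hc, MulChar.map_zero]
  simp only [mul_assoc (χ a * η c)]
  rw [← Finset.mul_sum, sum_quadratic_mul_ite hq ha hc,
    complexQuadraticChar_sub_comm hq (1 - c) 1, sub_sub_cancel]
  ring

/-- Each binomial is a Jacobi sum Σ A(a)ψ(a/(1-a)), up to ψ(-1)/q, and ψ(-1)³ = ψ(-1). Summing over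
ψ keeps the triples where the product of the arguments is 1, with weight q - 1, and one variable is
then determined by the other two. The powers of q combine to q/(q-1) · q⁻³ · (q-1) = q⁻². -/
theorem card_sq_mul_greeneHyp (hq : Fintype.card F % 8 = 5) (χ : MulChar F ℂ) :
    (Fintype.card F : ℂ) ^ 2 * greeneHyp ![χ, η, η] ![1, 1] 1 = twistedLegendreSum χ := by
  classical
  have : Fintype (MulChar F ℂ) := Fintype.ofFinite _
  have hcard : 2 < Fintype.card F := by
    have := Fintype.one_lt_card (α := F)
    omega
  have hq0 : (Fintype.card F : ℂ) ≠ 0 := by exact_mod_cast (by omega : Fintype.card F ≠ 0)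
  have hq1 : (Fintype.card F : ℂ) - 1 ≠ 0 := by
    rw [sub_ne_zero]
    exact_mod_cast (by omega : Fintype.card F ≠ 1)
  have hterm : ∀ ψ : MulChar F ℂ, charBinom (![χ, η, η] 0 * ψ) ψ *
      (∏ i : Fin 2, charBinom (![χ, η, η] i.succ * ψ) (![1, 1] i * ψ)) * ψ 1 =
      ((Fintype.card F : ℂ) ^ 3)⁻¹ * ∑ a, ∑ c, ∑ b, χ a * η c * η b *
        ψ (-1 * (a * (1 - a)⁻¹) * (c * (1 - c)⁻¹) * (b * (1 - b)⁻¹)) := by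
    intro ψ
    have hψ : ψ (-1) * ψ (-1) = 1 := by rw [← map_mul]; simp
    have hsum : ∑ a, ∑ c, ∑ b, χ a * η c * η b *
        ψ (-1 * (a * (1 - a)⁻¹) * (c * (1 - c)⁻¹) * (b * (1 - b)⁻¹)) =
        ψ (-1) * (jacobiSum (χ * ψ) ψ⁻¹ * (jacobiSum (η * ψ) ψ⁻¹ * jacobiSum (η * ψ) ψ⁻¹)) := by
      rw [jacobiSum_mul_inv_eq_sum, jacobiSum_mul_inv_eq_sum, Finset.sum_mul_sum,
        Finset.sum_mul_sum, Finset.mul_sum]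
      refine Finset.sum_congr rfl fun a _ => ?_
      rw [Finset.mul_sum]
      refine Finset.sum_congr rfl fun c _ => ?_
      rw [Finset.mul_sum, Finset.mul_sum]
      refine Finset.sum_congr rfl fun b _ => ?_
      rw [map_mul ψ _ (b * (1 - b)⁻¹), map_mul ψ _ (c * (1 - c)⁻¹), map_mul ψ (-1)]
      ring
    rw [hsum, Fin.prod_univ_two]
    simp only [charBinom, Matrix.cons_val_zero, Fin.succ_zero_eq_one, Fin.succ_one_eq_two,
      Matrix.cons_val_one, Matrix.cons_val, one_mul, MulChar.map_one, mul_one]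
    field_simp
    linear_combination ψ (-1) * jacobiSum (χ * ψ) ψ⁻¹ * jacobiSum (η * ψ) ψ⁻¹ ^ 2 * hψ
  rw [greeneHyp, finsum_eq_sum_of_fintype, Finset.sum_congr rfl fun ψ _ => hterm ψ,
    ← Finset.mul_sum]
  have hswap : ∑ ψ : MulChar F ℂ, ∑ a, ∑ c, ∑ b, χ a * η c * η b *
      ψ (-1 * (a * (1 - a)⁻¹) * (c * (1 - c)⁻¹) * (b * (1 - b)⁻¹)) =
      ((Fintype.card F : ℂ) - 1) * twistedLegendreSum χ := by
    rw [twistedLegendreSum_eq_sum_ite hq, Finset.sum_comm, Finset.mul_sum]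
    refine Finset.sum_congr rfl fun a _ => ?_
    rw [Finset.sum_comm, Finset.mul_sum]
    refine Finset.sum_congr rfl fun c _ => ?_
    rw [Finset.sum_comm, Finset.mul_sum]
    refine Finset.sum_congr rfl fun b _ => ?_
    rw [← Finset.mul_sum, sum_mulChar_apply]
    split_ifs <;> ring
  rw [hswap]
  field_simp

end Hypergeometric

/-! ### Prime powers: Lucas' theorem and uniqueness of the sum of two squares. -/

theorem prime_mod_four_eq_one_of_pow_mod_eight {p r : ℕ} (hq : p ^ r % 8 = 5) : p % 4 = 1 := by
  have hsq : ∀ n : ℕ, n % 2 = 1 → n ^ 2 % 8 = 1 := by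
    intro n hn
    have h : n % 8 = 1 ∨ n % 8 = 3 ∨ n % 8 = 5 ∨ n % 8 = 7 := by omega
    rcases h with h | h | h | h <;> simp [Nat.pow_mod, h]
  obtain ⟨k, rfl | rfl⟩ := Nat.even_or_odd' r
  · rcases Nat.mod_two_eq_zero_or_one p with hp | hp
    · rcases Nat.eq_zero_or_pos k with rfl | hk
      · simp at hq
      · have : p ^ (2 * k) % 2 = 0 := by
          rw [Nat.pow_mod, hp, Nat.zero_pow (by omega)]
        omega
    · rw [pow_mul, Nat.pow_mod, hsq p hp, one_pow] at hq
      omega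
  · have hp : p % 2 = 1 := by
      by_contra h
      have hp : p % 2 = 0 := by omega
      have : p ^ (2 * k + 1) % 2 = 0 := by
        rw [Nat.pow_mod, hp, Nat.zero_pow (by omega)]
      omega
    rw [pow_succ, pow_mul, Nat.mul_mod, Nat.pow_mod, hsq p hp, one_pow] at hq
    omega

/-- The central binomial coefficient of `(q - 1) / 4` is prime to `p`, by Lucas' theorem. -/
theorem not_dvd_choose_half_quarter {p : ℕ} (hp : p.Prime) (hp4 : p % 4 = 1) (r : ℕ) :
    ∃ k, p ^ r = 4 * k + 1 ∧ ¬ p ∣ (2 * k).choose k := by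
  have : Fact p.Prime := ⟨hp⟩
  obtain ⟨s, hs⟩ : ∃ s, p = 4 * s + 1 := ⟨p / 4, by omega⟩
  induction r with
  | zero => exact ⟨0, by simp, by simpa using hp.one_lt.ne'⟩
  | succ r ih =>
    obtain ⟨k, hk, hdvd⟩ := ih
    -- In base p, s is the last digit and k the rest; doubling produces no carry out of that digit,
    -- because 2s < p.
    refine ⟨s + p * k, ?_, ?_⟩
    · rw [pow_succ, hk]
      rw [show (4 * k + 1) * p = 4 * (p * k) + p by ring]
      generalize p * k = t
      omega
    · have h := @Choose.choose_modEq_choose_mod_mul_choose_div_nat (2 * s + p * (2 * k))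
        (s + p * k) p _
      rw [Nat.add_mul_mod_self_left, Nat.add_mul_mod_self_left, Nat.add_mul_div_left _ _ hp.pos,
        Nat.add_mul_div_left _ _ hp.pos, Nat.mod_eq_of_lt (by omega), Nat.mod_eq_of_lt (by omega),
        Nat.div_eq_of_lt (by omega), Nat.div_eq_of_lt (by omega), zero_add, zero_add] at h
      rw [show 2 * (s + p * k) = 2 * s + p * (2 * k) by ring, h.dvd_iff dvd_rfl, hp.dvd_mul]
      rintro (h' | h')
      · have h2 : (2 * s).choose s ∣ (2 * s).factorial :=
          ⟨_, (by
            rw [← Nat.choose_mul_factorial_mul_factorial (show s ≤ 2 * s by omega), mul_assoc])⟩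
        have := (hp.dvd_factorial).mp (h'.trans h2)
        omega
      · exact hdvd h'

/-- (x+iy)(a+ib) has norm q² and real part qk, so k is 0 or ±1. Parity excludes k = 0. Otherwise the
imaginary part vanishes and x = ±a, the sign being fixed modulo 4. -/
theorem int_eq_of_dvd_of_sq_add_sq {q x y a b : ℤ} (hq : 0 < q) (hq2 : q % 2 = 1)
    (h : q = x ^ 2 + y ^ 2) (hab : q = a ^ 2 + b ^ 2) (hx : x ≡ 1 [ZMOD 4])
    (ha : a ≡ 1 [ZMOD 4]) (hdvd : q ∣ x * a - y * b) : x = a := by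
  obtain ⟨k, hk⟩ := hdvd
  have hx2 : x % 2 = 1 := by have := hx; unfold Int.ModEq at this; omega
  have ha2 : a % 2 = 1 := by have := ha; unfold Int.ModEq at this; omega
  have hsum : q ^ 2 = (q * k) ^ 2 + (x * b + y * a) ^ 2 := by
    rw [← hk, sq]
    nth_rw 1 [h]
    rw [hab]
    ring
  have hk1 : k ^ 2 ≤ 1 := by
    by_contra hlt
    have : q ^ 2 * 1 < q ^ 2 * k ^ 2 := mul_lt_mul_of_pos_left (by omega) (by positivity)
    nlinarith [sq_nonneg (x * b + y * a)]
  have hk' : k = -1 ∨ k = 0 ∨ k = 1 := by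
    have h1 : k ≤ 1 := by nlinarith
    have h2 : -1 ≤ k := by nlinarith
    omega
  have hxk : k ≠ 0 → x = a * k := by
    intro hk0
    have hkk : k ^ 2 = 1 := by
      rcases hk' with rfl | rfl | rfl
      · norm_num
      · exact absurd rfl hk0
      · norm_num
    have h0 : x * b + y * a = 0 := by
      have : (x * b + y * a) ^ 2 = 0 := by linear_combination -hsum - q ^ 2 * hkk
      exact pow_eq_zero_iff two_ne_zero |>.mp this
    refine mul_left_cancel₀ hq.ne' ?_
    nth_rw 1 [hab]
    linear_combination a * hk + b * h0
  rcases hk' with rfl | rfl | rfl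
  · have := hxk (by norm_num)
    unfold Int.ModEq at hx ha
    omega
  · exfalso
    rw [mul_zero] at hk
    have hodd : (x * a) % 2 = 1 := by rw [Int.mul_emod, hx2, ha2]; rfl
    have hy : y % 2 = 0 := by
      by_contra hy
      have hy : y % 2 = 1 := by omega
      have : (x ^ 2 + y ^ 2) % 2 = 0 := by
        rw [sq, sq, Int.add_emod, Int.mul_emod, Int.mul_emod y, hx2, hy]; rfl
      omega
    have heven : (y * b) % 2 = 0 := by rw [Int.mul_emod, hy, zero_mul]; rfl
    omega
  · simpa using hxk one_ne_zero

/-- An odd prime power is a sum of two squares prime to it in essentially one way. -/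
theorem int_eq_of_prime_pow_eq_sq_add_sq {p r : ℕ} (hp : p.Prime) (hp2 : p % 2 = 1)
    {x y a b : ℤ} (h : (p : ℤ) ^ r = x ^ 2 + y ^ 2) (hab : (p : ℤ) ^ r = a ^ 2 + b ^ 2)
    (hx : x ≡ 1 [ZMOD 4]) (ha : a ≡ 1 [ZMOD 4]) (hpx : ¬ (p : ℤ) ∣ x) (hpa : ¬ (p : ℤ) ∣ a) :
    x = a := by
  have hpz : Prime (p : ℤ) := Nat.prime_iff_prime_int.mp hp
  have hq : 0 < (p : ℤ) ^ r := pow_pos (by exact_mod_cast hp.pos) r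
  have hq2 : (p : ℤ) ^ r % 2 = 1 := by
    have : p ^ r % 2 = 1 := by simp [Nat.pow_mod, hp2]
    exact_mod_cast this
  have hp2' : ¬ (p : ℤ) ∣ 2 := by
    intro hd
    have := Nat.le_of_dvd two_pos (by exact_mod_cast hd : p ∣ 2)
    have := hp.two_le
    omega
  have hprod : (p : ℤ) ^ r ∣ (x * a - y * b) * (x * a + y * b) :=
    ⟨x ^ 2 + a ^ 2 - (p : ℤ) ^ r, by
      linear_combination ((p : ℤ) ^ r - a ^ 2) * h + y ^ 2 * hab⟩
  -- p cannot divide both factors, since it would divide 2xa. So pʳ divides one of them; the choice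
  -- amounts to the sign of y.
  by_cases hd : (p : ℤ) ∣ x * a + y * b
  · have hd' : ¬ (p : ℤ) ∣ x * a - y * b := by
      intro hd'
      have h2 : (p : ℤ) ∣ 2 * (x * a) := by
        rw [show 2 * (x * a) = (x * a + y * b) + (x * a - y * b) by ring]
        exact dvd_add hd hd'
      rcases hpz.dvd_or_dvd h2 with h2 | h2
      · exact hp2' h2
      · exact (hpz.dvd_or_dvd h2).elim hpx hpa
    have hc : IsCoprime ((p : ℤ) ^ r) (x * a - y * b) :=
      ((hpz.irreducible.coprime_iff_not_dvd).mpr hd').pow_left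
    refine int_eq_of_dvd_of_sq_add_sq (y := -y) hq hq2 (by rw [h]; ring) hab hx ha ?_
    rw [neg_mul, sub_neg_eq_add]
    exact hc.dvd_of_dvd_mul_left hprod
  · have hc : IsCoprime ((p : ℤ) ^ r) (x * a + y * b) :=
      ((hpz.irreducible.coprime_iff_not_dvd).mpr hd).pow_left
    exact int_eq_of_dvd_of_sq_add_sq hq hq2 h hab hx ha (hc.dvd_of_dvd_mul_right hprod)

/-! ### Arithmetic of J(χ,η): its norm, and its real part modulo 4 and modulo p. -/

section JacobiSumArithmetic

variable {F : Type*} [Field F] [Fintype F] [DecidableEq F]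

local notation "η" => complexQuadraticChar F

theorem MulChar.quartic_eq_of_ne_zero {χ : MulChar F ℂ} (hχ : χ ^ 2 = η) {x : F} (hx : x ≠ 0) :
    χ x = 1 ∨ χ x = -1 ∨ χ x = Complex.I ∨ χ x = -Complex.I := by
  rcases complexQuadraticChar_eq_one_or_neg_one hx with h | h
  · rw [← MulChar.apply_mul_self_of_sq_eq hχ, mul_self_eq_one_iff] at h
    tauto
  · rw [← MulChar.apply_mul_self_of_sq_eq hχ, ← Complex.I_mul_I, mul_self_eq_mul_self_iff] at h
    tauto

/-- Each term of Σ (χ(x)-1)(η(1-x)-1) is divisible by 2(1-i): for x ≠ 0, 1 the factors are divisible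
by 1-i and 2, and at x = 0, 1 one factor is 0. -/
theorem jacobiSum_quartic_eq_neg_card_add (hq : Fintype.card F % 8 = 5) {χ : MulChar F ℂ}
    (hχ : χ ^ 2 = η) : ∃ m n : ℤ, jacobiSum χ η =
      -(Fintype.card F : ℂ) + 2 * (1 - Complex.I) * (m + n * Complex.I) := by
  have hsum : ∑ x, (χ x - 1) * (η (1 - x) - 1) = jacobiSum χ η + Fintype.card F := by
    calc _ = ∑ x, (χ x * η (1 - x) - χ x - η (1 - x) + 1) :=
          Finset.sum_congr rfl fun x _ => by ring
      _ = _ := by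
        simp only [Finset.sum_add_distrib, Finset.sum_sub_distrib]
        rw [MulChar.sum_eq_zero_of_ne_one (MulChar.quartic_ne_one hq hχ), sum_quadratic_sub' hq,
          jacobiSum]
        simp
  have hmem : ∃ m n : ℤ, ∑ x, (χ x - 1) * (η (1 - x) - 1) =
      2 * (1 - Complex.I) * (m + n * Complex.I) := by
    refine Finset.sum_induction _
      (fun z => ∃ m n : ℤ, z = 2 * (1 - Complex.I) * (m + n * Complex.I)) ?_ ⟨0, 0, by simp⟩ ?_
    · rintro _ _ ⟨m, n, rfl⟩ ⟨m', n', rfl⟩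
      exact ⟨m + m', n + n', by push_cast; ring⟩
    · intro x _
      by_cases hx : x = 0
      · exact ⟨0, 0, by simp [hx]⟩
      by_cases hx1 : x = 1
      · exact ⟨0, 0, by simp [hx1]⟩
      rcases complexQuadraticChar_eq_one_or_neg_one (sub_ne_zero.mpr (Ne.symm hx1)) with h | h
      · exact ⟨0, 0, by simp [h]⟩
      rw [h]
      rcases MulChar.quartic_eq_of_ne_zero hχ hx with h | h | h | h <;> rw [h]
      · exact ⟨0, 0, by simp⟩
      · exact ⟨1, 1, by push_cast; linear_combination 2 * Complex.I_mul_I⟩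
      · exact ⟨1, 0, by push_cast; ring⟩
      · exact ⟨0, 1, by push_cast; linear_combination 2 * Complex.I_mul_I⟩
  obtain ⟨m, n, h⟩ := hmem
  exact ⟨m, n, by rw [← h, hsum]; ring⟩

theorem jacobiSum_inv_quadratic_eq_conj (χ : MulChar F ℂ) :
    jacobiSum χ⁻¹ η = starRingEnd ℂ (jacobiSum χ η) := by
  rw [jacobiSum, jacobiSum, map_sum]
  refine Finset.sum_congr rfl fun x _ => ?_
  rw [map_mul, ← MulChar.star_apply', complexQuadraticChar_apply, map_intCast]
  rfl

theorem jacobiSum_mul_jacobiSum_inv_quadratic (hq : Fintype.card F % 8 = 5) {χ : MulChar F ℂ}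
    (hχ : χ ^ 2 = η) : jacobiSum χ η * jacobiSum χ⁻¹ η = Fintype.card F := by
  have h1 := MulChar.quartic_ne_one hq hχ
  have hF := ringChar_ne_two_of_card_mod_eight hq
  nth_rw 2 [← complexQuadraticChar_inv']
  refine jacobiSum_mul_jacobiSum_inv ?_ h1 (complexQuadraticChar_ne_one hF) ?_
  · rw [ringChar.eq_zero]
    exact (CharP.ringChar_ne_zero_of_finite F).symm
  · rw [MulChar.quartic_mul_quadratic hχ]
    exact inv_ne_one.mpr h1

/-- The Jacobi sum of a quartic and the quadratic character is a Gaussian integer of norm `q`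
with real part congruent to `1` modulo `4`. -/
theorem exists_jacobiSum_quartic_eq (hq : Fintype.card F % 8 = 5) {χ : MulChar F ℂ}
    (hχ : χ ^ 2 = η) : ∃ a b : ℤ, jacobiSum χ η = a + b * Complex.I ∧
      jacobiSum χ⁻¹ η = a - b * Complex.I ∧ (Fintype.card F : ℤ) = a ^ 2 + b ^ 2 ∧
      a ≡ 1 [ZMOD 4] := by
  obtain ⟨m, n, h⟩ := jacobiSum_quartic_eq_neg_card_add hq hχ
  have hJ : jacobiSum χ η = ((-(Fintype.card F : ℤ) + 2 * (m + n) : ℤ) : ℂ) +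
      ((2 * (n - m) : ℤ) : ℂ) * Complex.I := by
    rw [h]
    push_cast
    linear_combination -2 * n * Complex.I_mul_I
  have hJ' : jacobiSum χ⁻¹ η = ((-(Fintype.card F : ℤ) + 2 * (m + n) : ℤ) : ℂ) -
      ((2 * (n - m) : ℤ) : ℂ) * Complex.I := by
    rw [jacobiSum_inv_quadratic_eq_conj, hJ]
    simp only [map_add, map_mul, map_intCast, Complex.conj_I]
    ring
  have hnorm : (Fintype.card F : ℤ) =
      (-(Fintype.card F : ℤ) + 2 * (m + n)) ^ 2 + (2 * (n - m)) ^ 2 := by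
    have := jacobiSum_mul_jacobiSum_inv_quadratic hq hχ
    rw [hJ, hJ'] at this
    have h2 : ((Fintype.card F : ℤ) : ℂ) =
      (((-(Fintype.card F : ℤ) + 2 * (m + n)) ^ 2 + (2 * (n - m)) ^ 2 : ℤ) : ℂ) := by
      push_cast at this ⊢
      linear_combination -this - 4 * (n - m) ^ 2 * Complex.I_mul_I
    exact_mod_cast h2
  refine ⟨_, _, hJ, hJ', hnorm, ?_⟩
  obtain ⟨k, hk⟩ : ∃ k : ℤ, (Fintype.card F : ℤ) = 8 * k + 5 := ⟨Fintype.card F / 8, by omega⟩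
  rw [hk] at hnorm ⊢
  -- If m + n were even, so would be n - m; then 4 divides the imaginary part and the norm is 1
  -- modulo 8, against q ≡ 5.
  have hodd : (m + n) % 2 = 1 := by
    by_contra hne
    obtain ⟨s, hs⟩ : ∃ s, m + n = 2 * s := ⟨(m + n) / 2, by omega⟩
    have hn : n - m = 2 * (s - m) := by linarith
    rw [hs, hn] at hnorm
    have h4 : 4 * (2 * (8 * k ^ 2 - 8 * k * s + 2 * s ^ 2 + 9 * k - 5 * s + 2 * (s - m) ^ 2 + 2) +
        1) = 0 := by
      linear_combination -hnorm
    exact (by omega : ∀ t : ℤ, 4 * (2 * t + 1) ≠ 0) _ h4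
  unfold Int.ModEq
  omega

theorem FiniteField.sum_pow_eq_ite {K : Type*} [Field K] [Fintype K] {i : ℕ} (hi : i ≠ 0) :
    ∑ x : K, x ^ i = if Fintype.card K - 1 ∣ i then -1 else 0 := by
  classical
  rw [← FiniteField.sum_pow_units K i,
    ← Finset.sum_erase (f := fun x : K => x ^ i) Finset.univ (zero_pow hi)]
  refine (Finset.sum_bij (fun (x : Kˣ) _ => (x : K)) ?_ ?_ ?_ ?_).symm
  · intro x _
    simp
  · intro x _ y _ h
    exact Units.ext h
  · intro y hy
    exact ⟨Units.mk0 y (Finset.ne_of_mem_erase hy), Finset.mem_univ _, rfl⟩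
  · intro x _
    rfl

/-- A power sum over K with positive exponent survives only when q - 1 = 4k divides the exponent.
The exponents 2k + 2j lie between 2k and 6k, so only j = k remains. -/
theorem FiniteField.sum_mul_sq_sub_one_pow {K : Type*} [Field K] [Fintype K] {k : ℕ}
    (hk : Fintype.card K = 4 * k + 1) (hk0 : k ≠ 0) :
    ∑ w : K, (w * (w ^ 2 - 1)) ^ (2 * k) = -((-1) ^ k * ((2 * k).choose k : K)) := by
  have hexp : ∀ w : K, (w * (w ^ 2 - 1)) ^ (2 * k) = ∑ j ∈ Finset.range (2 * k + 1),
      (-1) ^ (2 * k - j) * ((2 * k).choose j : K) * w ^ (2 * k + 2 * j) := by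
    intro w
    rw [mul_pow, sub_eq_add_neg, add_pow, Finset.mul_sum]
    refine Finset.sum_congr rfl fun j _ => ?_
    rw [pow_add, ← pow_mul]
    ring
  rw [Finset.sum_congr rfl fun w _ => hexp w, Finset.sum_comm, Finset.sum_eq_single k]
  · rw [← Finset.mul_sum, FiniteField.sum_pow_eq_ite (by omega), hk,
      if_pos ⟨1, by omega⟩, show 2 * k - k = k by omega]
    ring
  · intro j hj hjk
    rw [← Finset.mul_sum, FiniteField.sum_pow_eq_ite (by omega), hk, if_neg, mul_zero]
    rintro ⟨t, ht⟩
    have hj' : j < 2 * k + 1 := Finset.mem_range.mp hj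
    rw [Nat.add_sub_cancel] at ht
    have ht1 : t = 1 := by
      rcases Nat.lt_or_ge t 2 with h | h
      · interval_cases t <;> omega
      · have : 4 * k * 2 ≤ 4 * k * t := Nat.mul_le_mul_left _ h
        omega
    subst ht1
    omega
  · intro h
    exact absurd (Finset.mem_range.mpr (by omega)) h

/-- In F, η(w) is w to the power (q-1)/2 = 2k. Reducing Σ η(w)η(w²-1) = 2a therefore makes 2a equal
to ± the binomial coefficient of 2k over k, a unit by `not_dvd_choose_half_quarter`. -/
theorem not_dvd_of_jacobiSum_quartic_eq {p r : ℕ} (hp : p.Prime) (hF : Fintype.card F = p ^ r)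
    (hq : Fintype.card F % 8 = 5) {χ : MulChar F ℂ} (hχ : χ ^ 2 = η) {a b : ℤ}
    (h : jacobiSum χ η = a + b * Complex.I) (h' : jacobiSum χ⁻¹ η = a - b * Complex.I) :
    ¬ (p : ℤ) ∣ a := by
  have hr : r ≠ 0 := by
    rintro rfl
    rw [hF] at hq
    simp at hq
  have : Fact p.Prime := ⟨hp⟩
  have hchar : CharP F p := charP_of_card_eq_prime_pow hF
  obtain ⟨k, hk, hdvd⟩ := not_dvd_choose_half_quarter hp
    (prime_mod_four_eq_one_of_pow_mod_eight (hF ▸ hq)) r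
  rw [← hF] at hk
  have hk0 : k ≠ 0 := by omega
  have hsum : ∑ w : F, quadraticChar F w * quadraticChar F (w ^ 2 - 1) = 2 * a := by
    have hs := sum_quadratic_mul_quadratic_sq_sub_one hq hχ
    rw [h, h'] at hs
    simp only [complexQuadraticChar_apply] at hs
    have : ((∑ w : F, quadraticChar F w * quadraticChar F (w ^ 2 - 1) : ℤ) : ℂ) =
        ((2 * a : ℤ) : ℂ) := by
      push_cast
      rw [hs]
      ring
    exact_mod_cast this
  intro ha
  have ha0 : (a : F) = 0 := (CharP.intCast_eq_zero_iff F p a).mpr ha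
  have hcast : ∑ w : F, (w * (w ^ 2 - 1)) ^ (2 * k) = 0 := by
    have hs := congrArg (Int.cast : ℤ → F) hsum
    push_cast at hs
    rw [ha0, mul_zero] at hs
    rw [← hs]
    refine Finset.sum_congr rfl fun w _ => ?_
    rw [quadraticChar_eq_pow_of_char_ne_two' (ringChar_ne_two_of_card_mod_eight hq),
      quadraticChar_eq_pow_of_char_ne_two' (ringChar_ne_two_of_card_mod_eight hq), ← mul_pow]
    congr 1
    omega
  rw [FiniteField.sum_mul_sq_sub_one_pow hk hk0, neg_eq_zero] at hcast
  have hc0 : ((2 * k).choose k : F) = 0 :=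
    (mul_eq_zero.mp hcast).resolve_left (pow_ne_zero _ (neg_ne_zero.mpr one_ne_zero))
  exact hdvd ((CharP.cast_eq_zero_iff F p _).mp hc0)

end JacobiSumArithmetic

/-! ### Assembly of the formula. -/

theorem corollary2p4 (p r : ℕ) (hp : p.Prime) (hq : p ^ r ≡ 5 [MOD 8])
    (F : Type*) [Field F] [Fintype F] (hF : Fintype.card F = p ^ r)
    (φ χ₄ : MulChar F ℂ) (hφ : orderOf φ = 2) (hχ₄ : orderOf χ₄ = 4) :
    (∃ x y : ℤ, (p : ℤ) ^ r = x ^ 2 + y ^ 2 ∧ x ≡ 1 [ZMOD 4] ∧ ¬ (p : ℤ) ∣ x) ∧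
    ∀ x y : ℤ, (p : ℤ) ^ r = x ^ 2 + y ^ 2 → x ≡ 1 [ZMOD 4] → ¬ (p : ℤ) ∣ x →
      ∀ q : ℂ, q = (p : ℂ) ^ r →
        (transSubtournamentCount 4 (paleyDigraph F 4) : ℂ) =
          q * (q - 1) / 2 ^ 12 *
            (q ^ 2 + 2 * q * (5 * (x : ℂ) - 21) + 24 * (x : ℂ) ^ 2 - 150 * (x : ℂ) + 241 +
              10 * q ^ 2 * greeneHyp ![χ₄, φ, φ] ![1, 1] 1) := by
  classical
  have hq8 : Fintype.card F % 8 = 5 := by rw [hF]; exact hq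
  have hp4 : p % 4 = 1 := prime_mod_four_eq_one_of_pow_mod_eight (hF ▸ hq8)
  have hχ := MulChar.sq_eq_complexQuadraticChar hχ₄
  obtain ⟨a, b, hJ, hJ', hnorm, ha⟩ := exists_jacobiSum_quartic_eq hq8 hχ
  have hpa := not_dvd_of_jacobiSum_quartic_eq hp hF hq8 hχ hJ hJ'
  have hab : (p : ℤ) ^ r = a ^ 2 + b ^ 2 := by rw [← hnorm, hF]; push_cast; rfl
  refine ⟨⟨a, b, hab, ha, hpa⟩, ?_⟩
  intro x y hxy hx hpx q hqp
  obtain rfl : x = a :=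
    int_eq_of_prime_pow_eq_sq_add_sq hp (by omega) hxy hab hx ha hpx hpa
  have hqF : q = Fintype.card F := by rw [hqp, hF]; push_cast; rfl
  have hqb : q = x ^ 2 + b ^ 2 := by rw [hqF]; exact_mod_cast hnorm
  have hcount : 4 * (transSubtournamentCount 4 (paleyDigraph F 4) : ℂ) =
      q * (q - 1) * Nat.card (QuarticPairs F) := by
    rw [hqF, ← Nat.cast_pred Fintype.card_pos]
    exact_mod_cast four_mul_transSubtournamentCount_paleyDigraph (F := F) (by omega)
  have hpairs := card_quarticPairs hq8 hχ
  have hU := card_squarePairs (F := F) hq8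
  have hV := sum_squarePairs_quartic hq8 hχ
  rw [twistedLegendreSum_quadratic hq8 hχ, hJ, hJ', ← hqF] at hU
  rw [twistedLegendreSum_inv hq8, ← card_sq_mul_greeneHyp hq8, hJ, hJ', ← hqF] at hV
  rw [MulChar.eq_complexQuadraticChar hφ]
  set G := greeneHyp ![χ₄, complexQuadraticChar F, complexQuadraticChar F] ![1, 1] (1 : F)
  have hb : (b : ℂ) ^ 2 = q - x ^ 2 := by rw [hqb]; ring
  -- J(χ,η)² + J(χ⁻¹,η)² = 2x² - 2b² = 4x² - 2q.
  have hU' : 32 * ((squarePairs F).card : ℂ) = q ^ 2 - 22 * q + 81 + 4 * x ^ 2 := by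
    linear_combination hU + 2 * b ^ 2 * Complex.I_sq - 2 * hb
  have hV' : 16 * ∑ z ∈ squarePairs F, χ₄ z.1 =
      q ^ 2 * G + q * x - 2 * q + 2 * x ^ 2 - 15 * x + 16 := by
    linear_combination hV / 2 + b ^ 2 * Complex.I_sq - hb
  have hN : (1024 : ℂ) * Nat.card (QuarticPairs F) =
      q ^ 2 + 2 * q * (5 * (x : ℂ) - 21) + 24 * (x : ℂ) ^ 2 - 150 * (x : ℂ) + 241 +
        10 * q ^ 2 * G := by
    linear_combination 32 * hpairs + hU' + 10 * hV'
  rw [← hN]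
  linear_combination hcount / 4
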